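/- For $\mu=(a,b,c)\in\mathbb R^3$ consider the quartic Kukles system $$X_\mu:\qquad \dot x=-y,\qquad \dot y=x+y\,(x^2+y^2-1)(ax+by+c).$$ A \emph{limit cycle} of $X_\mu$ is a (nonconstant) periodic orbit having a neighbourhood that contains no other periodic orbit. The origin is a \emph{weak focus of order $1$} of a polynomial system with linear part $(-y,x)$ if there is a polynomial $V=\tfrac12(x^2+y^2)+V_3+V_4+\cdots$ ($V_j$ homogeneous of degree $j$) whose derivative along the system is $\dot V=\eta\,(x^2+y^2)^2+(\text{terms of degree}\ge 5)$ with $\eta\neq 0$. \textbf{Theorem.} There are a nonempty open set $\mathcal N\subset\mathbb R^3$, for each $\mu\in\mathcal N$ a limit cycle $\Gamma_\mu$ of $X_\mu$, and a continuous function $\rho:\mathcal N\to(0,\infty)$ with $(\rho(\mu),0)\in\Gamma_\mu$, such that $\Gamma_\mu$ is a small-amplitude limit cycle, born in a Hopf bifurcation from the order-$1$ weak focus at the origin of $X_{(a,b,0)}$, $ab\ne0$, when $c$ is moved off $0$ with sign opposite to that of $ab$. Precisely: (i) If $(a,b,c)\in\mathcal N$, then $abc<0$, and $(a,b,sc)\in\mathcal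 N$ for all $0<s\le 1$. (ii) For all $a,b\in\mathbb R$ with $ab\neq0$: - the origin is a weak focus of order $1$ of $X_{(a,b,0)}$; - for $c$ near $0$ the origin is an equilibrium of $X_{(a,b,c)}$ whose Jacobian matrix has an eigenvalue depending continuously on $c$ that is nonzero and purely imaginary at $c=0$, and whose real part has nonzero derivative with respect to $c$ at $c=0$; - for every $\varepsilon>0$ there is a neighbourhood $W$ of $(a,b,0)$ in $\mathbb R^3$ such that every $\mu'=(a',b',c')\in W$ with $a'b'c'<0$ belongs to $\mathcal N$ and satisfies $\Gamma_{\mu'}\subset\{(x,y):\max(|x|,|y|)<\varepsilon\}$. -/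

import Mathlib

/-- A polynomial vector field on the plane: its two components, as polynomials in the
coordinates `x = X 0` and `y = X 1`. -/
abbrev PlanarField := Fin 2 → MvPolynomial (Fin 2) ℝ

namespace PlanarField

/-- The vector `F(p)`. -/
noncomputable def toFun (F : PlanarField) (p : Fin 2 → ℝ) : Fin 2 → ℝ :=
  fun i => MvPolynomial.eval p (F i)

/-- The Jacobian matrix of `F` at the origin. -/
noncomputable def jacobianZero (F : PlanarField) : Matrix (Fin 2) (Fin 2) ℝ :=
  Matrix.of fun i j => MvPolynomial.eval 0 (MvPolynomial.pderiv j (F i))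

/-- The derivative `V̇ = F₁ ∂V/∂x + F₂ ∂V/∂y` of `V` along `F`. -/
noncomputable def orbitalDeriv (F : PlanarField) (V : MvPolynomial (Fin 2) ℝ) :
    MvPolynomial (Fin 2) ℝ :=
  ∑ i, F i * MvPolynomial.pderiv i V

/-- `C` is the trace of a nonconstant periodic solution of `ṗ = F(p)`. -/
def IsPeriodicOrbit (F : PlanarField) (C : Set (Fin 2 → ℝ)) : Prop :=
  ∃ (γ : ℝ → Fin 2 → ℝ) (T : ℝ), 0 < T ∧ (∀ t, HasDerivAt γ (F.toFun (γ t)) t) ∧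
    (∀ t, γ (t + T) = γ t) ∧ (∃ s t, γ s ≠ γ t) ∧ C = Set.range γ

/-- A limit cycle: a periodic orbit that is the only periodic orbit in some
neighborhood of itself. -/
def IsLimitCycle (F : PlanarField) (C : Set (Fin 2 → ℝ)) : Prop :=
  F.IsPeriodicOrbit C ∧
    ∃ U : Set (Fin 2 → ℝ), IsOpen U ∧ C ⊆ U ∧
      ∀ C' : Set (Fin 2 → ℝ), F.IsPeriodicOrbit C' → C' ⊆ U → C' = C

/-- The origin is a weak focus of order `k` of `F`: the linear part of `F` is `(-y, x)`, and
there is `V = (x² + y²)/2 + V₃ + V₄ + ⋯` with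
`V̇ = η (x² + y²)^(k+1) + (terms of degree > 2k + 2)` and `η ≠ 0`; that is, the focal values
`η₂, …, η₂ₖ` vanish and `η₂ₖ₊₂ = η` does not. -/
def IsWeakFocusOfOrder (F : PlanarField) (k : ℕ) : Prop :=
  F.toFun 0 = 0 ∧ F.jacobianZero = !![0, -1; 1, 0] ∧
    ∃ (V : MvPolynomial (Fin 2) ℝ) (η : ℝ), η ≠ 0 ∧
      MvPolynomial.homogeneousComponent 0 V = 0 ∧
      MvPolynomial.homogeneousComponent 1 V = 0 ∧
      MvPolynomial.homogeneousComponent 2 V =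
        MvPolynomial.C (1 / 2) * (MvPolynomial.X 0 ^ 2 + MvPolynomial.X 1 ^ 2) ∧
      (∀ j < 2 * k + 2, MvPolynomial.homogeneousComponent j (F.orbitalDeriv V) = 0) ∧
      MvPolynomial.homogeneousComponent (2 * k + 2) (F.orbitalDeriv V) =
        MvPolynomial.C η * (MvPolynomial.X 0 ^ 2 + MvPolynomial.X 1 ^ 2) ^ (k + 1)

/-- The Hopf eigenvalue condition for a one-parameter family of fields at the parameter `c₀`:
for `c` near `c₀` the origin is an equilibrium whose Jacobian matrix has an eigenvalue `ev c`
that is purely imaginary and nonzero at `c₀` and whose real part crosses zero there with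
nonzero speed (the other eigenvalue is its conjugate). -/
def HopfCrossing (F : ℝ → PlanarField) (c₀ : ℝ) : Prop :=
  ∃ (ev : ℝ → ℂ) (d : ℝ),
    (∀ᶠ c in nhds c₀, (F c).toFun 0 = 0 ∧
      (((F c).jacobianZero).map (algebraMap ℝ ℂ)).charpoly.IsRoot (ev c)) ∧
    ContinuousAt ev c₀ ∧ (ev c₀).re = 0 ∧ (ev c₀).im ≠ 0 ∧
    HasDerivAt (fun c => (ev c).re) d c₀ ∧ d ≠ 0

end PlanarField

/-- The quartic Kukles system `ẋ = -y`, `ẏ = x + y (x² + y² - 1) (a x + b y + c)`,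
with parameter `μ = (a, b, c)`. -/
noncomputable def kukles (μ : ℝ × ℝ × ℝ) : PlanarField :=
  ![-MvPolynomial.X 1,
    MvPolynomial.X 0 +
      MvPolynomial.X 1 * (MvPolynomial.X 0 ^ 2 + MvPolynomial.X 1 ^ 2 - 1) *
        (MvPolynomial.C μ.1 * MvPolynomial.X 0 + MvPolynomial.C μ.2.1 * MvPolynomial.X 1 +
          MvPolynomial.C μ.2.2)]

/-!
The weak focus and the eigenvalue condition are computations: an explicit polynomial of degree four
(`Kukles.lyapPoly`) has derivative `-(ab/8) (x² + y²)² + ⋯` along the system with `c = 0`, and the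
eigenvalues at the origin are the roots of `λ² + cλ + 1`.

For the limit cycles, the plane is rescaled by `L = 1 + |a| + |b|`, so that `α = a / L` and
`β = b / L` are at most one in absolute value, and orbits near the origin become graphs `R(θ)` of
solutions of a scalar `2π`-periodic equation `R' = R g(θ, R)`. Instead of expanding the return map,
the proof uses the corrected logarithmic radius
`Φ(θ, R) = log R + R A(θ) + R² B(θ) - (c/2) sin θ cos θ` (`Kukles.lyap`), where the trigonometric
polynomials `A` and `B` remove all oscillating terms up to second order. Along solutions,
`Φ' = -c/2 - (αβ/8) R² + ⋯`. If `abc < 0` the two displayed terms balance at `R = d`, where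
`4 |c| = |αβ| d²`, and for `d` small compared with `|αβ|` the omitted terms are negligible in the
annulus `d/4 ≤ R ≤ 4d` (`Kukles.exists_isThreshold`): there `αβ Φ'` is positive for small `R`,
negative for large `R`, and strictly decreasing in `R`.

The sign change makes the return map move the two ends `d/2` and `2d` in opposite directions, hence
it has a fixed point. For two solutions `R < R'` in the annulus, `αβ (Φ(θ, R') - Φ(θ, R))` is
strictly decreasing in `θ`, so it cannot return to its initial value after some turns
(`Kukles.IsSmall.eq_of_periodic`): the fixed point is unique, and so is the periodic orbit in the
annulus. Uniqueness, the signs of the displacement on both sides of the fixed point, and the joint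
continuity of the return map in the initial radius and the parameters give the continuity of the
fixed point in the parameters. As `d → 0` when `c → 0`, the cycle shrinks to the origin.
-/

namespace Kukles

/-! ### The weak focus and the eigenvalues at the origin -/

section
open MvPolynomial

lemma jacobianZero_kukles (a b c : ℝ) :
    (kukles (a, b, c)).jacobianZero = !![0, -1; 1, -c] := by
  ext i j
  fin_cases i <;> fin_cases j <;>
    simp [PlanarField.jacobianZero, kukles, pderiv_X, Derivation.leibniz]

lemma kukles_toFun_zero (μ : ℝ × ℝ × ℝ) : (kukles μ).toFun 0 = 0 := by
  ext i
  fin_cases i <;> simp [PlanarField.toFun, kukles]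

/-- The eigenvalue followed is `-c / 2 + i √(1 - c² / 4)`, a root of `λ² + c λ + 1`. -/
theorem hopfCrossing_kukles (a b : ℝ) :
    PlanarField.HopfCrossing (fun c => kukles (a, b, c)) 0 := by
  have hev : ContinuousAt (fun c : ℝ => (⟨-c / 2, √(1 - c ^ 2 / 4)⟩ : ℂ)) 0 := by
    have : Continuous fun c : ℝ => (⟨-c / 2, √(1 - c ^ 2 / 4)⟩ : ℂ) := by
      have h : (fun c : ℝ => (⟨-c / 2, √(1 - c ^ 2 / 4)⟩ : ℂ)) =
          fun c : ℝ => ((-c / 2 : ℝ) : ℂ) + (√(1 - c ^ 2 / 4) : ℝ) * Complex.I := by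
        funext c
        rw [Complex.mk_eq_add_mul_I]
      rw [h]
      fun_prop
    exact this.continuousAt
  refine ⟨fun c => ⟨-c / 2, √(1 - c ^ 2 / 4)⟩, -1 / 2, ?_, hev, by simp, by simp, ?_, by norm_num⟩
  · filter_upwards [Metric.ball_mem_nhds (0 : ℝ) one_pos] with c hc
    refine ⟨kukles_toFun_zero _, ?_⟩
    rw [mem_ball_zero_iff, Real.norm_eq_abs] at hc
    have h1 : 0 ≤ 1 - c ^ 2 / 4 := by
      have := (sq_le_one_iff_abs_le_one c).2 hc.le
      linarith
    have h2 := Real.mul_self_sqrt h1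
    rw [jacobianZero_kukles, Matrix.charpoly_fin_two, Polynomial.IsRoot.def]
    simp only [Matrix.trace_fin_two, Matrix.det_fin_two, Matrix.map_apply]
    rw [Complex.ext_iff]
    constructor
    · rw [pow_two] at h2
      simp [pow_two]
      linarith
    · simp [pow_two]
      ring
  · simpa using ((hasDerivAt_id (0 : ℝ)).neg.div_const 2)

/-- The function `(x² + y²) / 2 + V₃ + V₄`. Its cubic and quartic parts make the cubic terms of
the orbital derivative at `c = 0` vanish and reduce the quartic ones to a multiple of
`(x² + y²)²`. -/
noncomputable def lyapPoly (a b : ℝ) : MvPolynomial (Fin 2) ℝ :=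
  C (1 / 2) * (X 0 ^ 2 + X 1 ^ 2)
  + (C (a / 3) * X 1 ^ 3 + C (-b) * (X 0 * X 1 ^ 2) + C (-2 * b / 3) * X 0 ^ 3)
  + (C ((a ^ 2 - 2 * b ^ 2) / 4) * X 1 ^ 4 + C (-7 * a * b / 8) * (X 0 * X 1 ^ 3)
    + C (-(a * b) / 8) * (X 0 ^ 3 * X 1))

/-- The four summands on the right are homogeneous of degrees 4, 5, 6 and 7. -/
lemma orbitalDeriv_lyapPoly (a b : ℝ) :
    (kukles (a, b, 0)).orbitalDeriv (lyapPoly a b) =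
      C (-(a * b) / 8) * (X 0 ^ 2 + X 1 ^ 2) ^ 2
      + X 1 * (C a * X 0 + C b * X 1) * ((X 0 ^ 2 + X 1 ^ 2) * X 1
        - (C (a ^ 2 - 2 * b ^ 2) * X 1 ^ 3 + C (-21 * a * b / 8) * (X 0 * X 1 ^ 2)
          + C (-(a * b) / 8) * X 0 ^ 3))
      + X 1 * (C a * X 0 + C b * X 1) * (X 0 ^ 2 + X 1 ^ 2)
        * (C a * X 1 ^ 2 + C (-2 * b) * (X 0 * X 1))
      + X 1 * (C a * X 0 + C b * X 1) * (X 0 ^ 2 + X 1 ^ 2)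
        * (C (a ^ 2 - 2 * b ^ 2) * X 1 ^ 3 + C (-21 * a * b / 8) * (X 0 * X 1 ^ 2)
          + C (-(a * b) / 8) * X 0 ^ 3) := by
  have h01 : (0 : Fin 2) ≠ 1 := by decide
  simp only [PlanarField.orbitalDeriv, lyapPoly, kukles, Fin.sum_univ_two, map_add,
    Derivation.leibniz, pderiv_C, pderiv_X_self, pderiv_X_of_ne h01, pderiv_X_of_ne h01.symm,
    Derivation.leibniz_pow, smul_eq_mul, nsmul_eq_mul]
  simp only [Matrix.cons_val_zero, Matrix.cons_val_one, Matrix.cons_val_fin_one]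
  refine MvPolynomial.funext fun x => ?_
  simp
  ring

theorem isWeakFocusOfOrder_kukles {a b : ℝ} (hab : a * b ≠ 0) :
    (kukles (a, b, 0)).IsWeakFocusOfOrder 1 := by
  have hX0 : (X 0 : MvPolynomial (Fin 2) ℝ).IsHomogeneous 1 := isHomogeneous_X _ _
  have hX1 : (X 1 : MvPolynomial (Fin 2) ℝ).IsHomogeneous 1 := isHomogeneous_X _ _
  have hr : (X 0 ^ 2 + X 1 ^ 2 : MvPolynomial (Fin 2) ℝ).IsHomogeneous 2 :=
    (hX0.pow 2).add (hX1.pow 2)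
  have hl : (X 1 * (C a * X 0 + C b * X 1) : MvPolynomial (Fin 2) ℝ).IsHomogeneous 2 :=
    hX1.mul ((hX0.C_mul a).add (hX1.C_mul b))
  have hV2 := hr.C_mul (1 / 2)
  have hV3 : (C (a / 3) * X 1 ^ 3 + C (-b) * (X 0 * X 1 ^ 2) + C (-2 * b / 3) * X 0 ^ 3 :
      MvPolynomial (Fin 2) ℝ).IsHomogeneous 3 :=
    (((hX1.pow 3).C_mul _).add ((hX0.mul (hX1.pow 2)).C_mul _)).add ((hX0.pow 3).C_mul _)
  have hV4 : (C ((a ^ 2 - 2 * b ^ 2) / 4) * X 1 ^ 4 + C (-7 * a * b / 8) * (X 0 * X 1 ^ 3)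
      + C (-(a * b) / 8) * (X 0 ^ 3 * X 1) : MvPolynomial (Fin 2) ℝ).IsHomogeneous 4 :=
    (((hX1.pow 4).C_mul _).add ((hX0.mul (hX1.pow 3)).C_mul _)).add (((hX0.pow 3).mul hX1).C_mul _)
  have hW3 : (C (a ^ 2 - 2 * b ^ 2) * X 1 ^ 3 + C (-21 * a * b / 8) * (X 0 * X 1 ^ 2)
      + C (-(a * b) / 8) * X 0 ^ 3 : MvPolynomial (Fin 2) ℝ).IsHomogeneous 3 :=
    (((hX1.pow 3).C_mul _).add ((hX0.mul (hX1.pow 2)).C_mul _)).add ((hX0.pow 3).C_mul _)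
  have hW2 : (C a * X 1 ^ 2 + C (-2 * b) * (X 0 * X 1) :
      MvPolynomial (Fin 2) ℝ).IsHomogeneous 2 :=
    ((hX1.pow 2).C_mul _).add ((hX0.mul hX1).C_mul _)
  have hD4 := (hr.pow 2).C_mul (-(a * b) / 8)
  have hD5 := hl.mul ((hr.mul hX1).sub hW3)
  have hD6 := (hl.mul hr).mul hW2
  have hD7 := (hl.mul hr).mul hW3
  have hne : ∀ {p : MvPolynomial (Fin 2) ℝ} {m : ℕ}, p.IsHomogeneous m → ∀ n, n ≠ m →
      homogeneousComponent n p = 0 := fun {p m} hp n hnm => by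
    rw [homogeneousComponent_of_mem ((mem_homogeneousSubmodule m p).2 hp), if_neg hnm]
  refine ⟨kukles_toFun_zero _, by rw [jacobianZero_kukles, neg_zero], lyapPoly a b, -(a * b) / 8,
    div_ne_zero (neg_ne_zero.2 hab) (by norm_num), ?_, ?_, ?_, fun j hj => ?_, ?_⟩
  · rw [lyapPoly, map_add, map_add, hne hV2 0 (by norm_num), hne hV3 0 (by norm_num),
      hne hV4 0 (by norm_num), add_zero, add_zero]
  · rw [lyapPoly, map_add, map_add, hne hV2 1 (by norm_num), hne hV3 1 (by norm_num),
      hne hV4 1 (by norm_num), add_zero, add_zero]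
  · rw [lyapPoly, map_add, map_add, homogeneousComponent_eq_self hV2, hne hV3 2 (by norm_num),
      hne hV4 2 (by norm_num), add_zero, add_zero]
  · rw [orbitalDeriv_lyapPoly, map_add, map_add, map_add, hne hD4 j (by omega),
      hne hD5 j (by omega), hne hD6 j (by omega), hne hD7 j (by omega)]
    simp
  · rw [orbitalDeriv_lyapPoly, map_add, map_add, map_add, homogeneousComponent_eq_self hD4,
      hne hD5 _ (by norm_num), hne hD6 _ (by norm_num), hne hD7 _ (by norm_num)]
    simp

end

open Real Set Filter Topology
open scoped NNReal

/-! ### The polar equation and the corrected logarithmic radius -/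

/-- The factor `(x² + y² - 1) (a x + b y + c)` in rescaled polar coordinates `x = r k / L`,
`y = r s / L`, where `k` and `s` stand for `cos θ` and `sin θ`, and `e = 1 / L²`, `α = a / L`,
`β = b / L`. -/
noncomputable def damping (e α β c k s r : ℝ) : ℝ := (e * r ^ 2 - 1) * (r * (α * k + β * s) + c)

/-- The logarithmic derivative `d (log r) / d θ` along orbits; the denominator is the angular
speed. -/
noncomputable def radialRate (e α β c k s r : ℝ) : ℝ :=
  s ^ 2 * damping e α β c k s r / (1 + s * k * damping e α β c k s r)

/-- The antiderivative in `θ` of `sin² θ (α cos θ + β sin θ)` that vanishes at `θ = 0`, with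
`k = cos θ` and `s = sin θ`. It compensates the terms of order `r` in `radialRate`. -/
noncomputable def corrA (α β k s : ℝ) : ℝ := α * s ^ 3 / 3 + β * (2 / 3 - k + k ^ 3 / 3)

/-- The second-order correction: its `θ`-derivative compensates the oscillating part of the terms
of order `r²`, leaving only their mean `-α β / 8`. -/
noncomputable def corrB (α β k s : ℝ) : ℝ :=
  corrA α β k s ^ 2 / 2 + (α ^ 2 * (s ^ 4 / 4 - s ^ 6 / 6) + β ^ 2 * (s ^ 6 / 6) +
    2 * (α * β) * (s * k * (-1 / 16 - s ^ 2 / 24 + s ^ 4 / 6)))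

/-- The corrected logarithmic radius. The last term compensates the oscillating part of
`-c sin² θ`. -/
noncomputable def lyap (α β c θ r : ℝ) : ℝ :=
  log r + r * corrA α β (cos θ) (sin θ) + r ^ 2 * corrB α β (cos θ) (sin θ)
    - c / 2 * (sin θ * cos θ)

/-- The derivative of `lyap` along orbits, as a function of `k = cos θ`, `s = sin θ` and `r`. -/
noncomputable def lyapRate (e α β c k s r : ℝ) : ℝ :=
  radialRate e α β c k s r * (1 + r * corrA α β k s + 2 * r ^ 2 * corrB α β k s)
    + r * (s ^ 2 * (α * k + β * s))
    + r ^ 2 * (corrA α β k s * (s ^ 2 * (α * k + β * s))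
        + (s ^ 3 * k * (α * k + β * s) ^ 2 - α * β / 8))
    - c / 2 * (1 - 2 * s ^ 2)

lemma hasDerivAt_corrA (α β θ : ℝ) :
    HasDerivAt (fun θ => corrA α β (cos θ) (sin θ))
      (sin θ ^ 2 * (α * cos θ + β * sin θ)) θ := by
  unfold corrA
  have h := (((hasDerivAt_sin θ).pow 3).const_mul (α / 3)).add
    ((((hasDerivAt_const θ (2 / 3 : ℝ)).sub (hasDerivAt_cos θ)).add
      (((hasDerivAt_cos θ).pow 3).const_mul (1 / 3))).const_mul β)
  refine (h.congr_deriv ?_).congr_of_eventuallyEq (Eventually.of_forall fun x => ?_)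
  · have h1 : cos θ ^ 2 = 1 - sin θ ^ 2 := by linarith [sin_sq_add_cos_sq θ]
    simp only [h1, Nat.add_one_sub_one, Nat.cast_ofNat]
    ring
  · simp only [Pi.add_apply, Pi.sub_apply, Pi.pow_apply]
    ring

lemma hasDerivAt_corrB (α β θ : ℝ) :
    HasDerivAt (fun θ => corrB α β (cos θ) (sin θ))
      (corrA α β (cos θ) (sin θ) * (sin θ ^ 2 * (α * cos θ + β * sin θ))
        + (sin θ ^ 3 * cos θ * (α * cos θ + β * sin θ) ^ 2 - α * β / 8)) θ := by
  unfold corrB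
  have hs := hasDerivAt_sin θ
  have hk := hasDerivAt_cos θ
  have h := (((hasDerivAt_corrA α β θ).pow 2).const_mul (1 / 2)).add
    (((((hs.pow 4).const_mul (1 / 4)).sub ((hs.pow 6).const_mul (1 / 6))).const_mul (α ^ 2)).add
      (((hs.pow 6).const_mul (β ^ 2 / 6))) |>.add
      (((hs.mul hk).mul (((hs.pow 4).const_mul (1 / 6)).sub ((hs.pow 2).const_mul (1 / 24))
        |>.sub_const (1 / 16))).const_mul (2 * (α * β))))
  refine (h.congr_deriv ?_).congr_of_eventuallyEq (Eventually.of_forall fun x => ?_)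
  · have h1 : cos θ ^ 2 = 1 - sin θ ^ 2 := by linarith [sin_sq_add_cos_sq θ]
    have h3 : cos θ ^ 3 = (1 - sin θ ^ 2) * cos θ := by rw [← h1]; ring
    simp only [Pi.pow_apply, Pi.mul_apply, Pi.sub_apply]
    push_cast
    ring_nf
    simp only [h1, h3]
    ring
  · simp only [Pi.add_apply, Pi.sub_apply, Pi.pow_apply, Pi.mul_apply]
    ring

lemma hasDerivAt_lyap {e α β c θ : ℝ} {R : ℝ → ℝ} (hR : 0 < R θ)
    (h : HasDerivAt R (R θ * radialRate e α β c (cos θ) (sin θ) (R θ)) θ) :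
    HasDerivAt (fun θ => lyap α β c θ (R θ))
      (lyapRate e α β c (cos θ) (sin θ) (R θ)) θ := by
  unfold lyap lyapRate
  have := ((h.log hR.ne').add (h.mul (hasDerivAt_corrA α β θ))).add
    ((h.pow 2).mul (hasDerivAt_corrB α β θ)) |>.sub
    (((hasDerivAt_sin θ).mul (hasDerivAt_cos θ)).const_mul (c / 2))
  refine (this.congr_deriv ?_).congr_of_eventuallyEq (Eventually.of_forall fun x => rfl)
  have h1 : cos θ ^ 2 = 1 - sin θ ^ 2 := by linarith [sin_sq_add_cos_sq θ]
  have h2 : R θ * radialRate e α β c (cos θ) (sin θ) (R θ) / R θ =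
    radialRate e α β c (cos θ) (sin θ) (R θ) := mul_div_cancel_left₀ _ hR.ne'
  rw [h2]
  generalize radialRate e α β c (cos θ) (sin θ) (R θ) = g
  generalize corrA α β (cos θ) (sin θ) = A
  generalize corrB α β (cos θ) (sin θ) = B
  simp only [Pi.pow_apply, Nat.add_one_sub_one, Nat.cast_ofNat]
  linear_combination (-c / 2) * h1

/-- The third-order part of `lyapRate` when `r` is of order `δ` and `c` of order `δ²`: it is the
coefficient of `δ³` for `r = δ ρ` and `c = δ² κ`. -/
noncomputable def remainder (e α β κ k s δ ρ : ℝ) : ℝ :=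
  -2 * s ^ 2 * (α * k + β * s) * corrB α β k s * ρ ^ 3
  - s ^ 2 * κ * (ρ * corrA α β k s + 2 * δ * ρ ^ 2 * corrB α β k s)
  - s ^ 3 * k * (2 * ρ * (α * k + β * s) * κ + δ * κ ^ 2)
  - s ^ 3 * k * (ρ * (α * k + β * s) + δ * κ) ^ 2 *
    ((-2 * e * δ * ρ ^ 2 + e ^ 2 * δ ^ 3 * ρ ^ 4) *
      (1 + δ * ρ * corrA α β k s + 2 * δ ^ 2 * ρ ^ 2 * corrB α β k s)
      + ρ * corrA α β k s + 2 * δ * ρ ^ 2 * corrB α β k s)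
  + (1 + δ * ρ * corrA α β k s + 2 * δ ^ 2 * ρ ^ 2 * corrB α β k s) *
    (e * ρ ^ 2 * s ^ 2 * (ρ * (α * k + β * s) + δ * κ)
      + s ^ 4 * k ^ 2 * ((e * δ ^ 2 * ρ ^ 2 - 1) * (ρ * (α * k + β * s) + δ * κ)) ^ 3 /
        (1 + s * k * (δ * ((e * δ ^ 2 * ρ ^ 2 - 1) * (ρ * (α * k + β * s) + δ * κ)))))

lemma damping_scale (e α β κ k s δ ρ : ℝ) : damping e α β (δ ^ 2 * κ) k s (δ * ρ) =
    δ * ((e * δ ^ 2 * ρ ^ 2 - 1) * (ρ * (α * k + β * s) + δ * κ)) := by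
  unfold damping; ring

/-- The terms of order `δ` cancel by the choice of `corrA`, and those of order `δ²` are freed from
`θ` by the choice of `corrB`. -/
lemma lyapRate_eq {e α β κ k s δ ρ : ℝ}
    (h : 1 + s * k * damping e α β (δ ^ 2 * κ) k s (δ * ρ) ≠ 0) :
    lyapRate e α β (δ ^ 2 * κ) k s (δ * ρ) =
      δ ^ 2 * (-(κ / 2) - α * β / 8 * ρ ^ 2) + δ ^ 3 * remainder e α β κ k s δ ρ := by
  unfold lyapRate radialRate remainder
  rw [damping_scale] at h ⊢
  have key : ∀ q : ℝ, 1 + s * k * (δ * q) ≠ 0 → s ^ 2 * (δ * q) / (1 + s * k * (δ * q)) =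
      s ^ 2 * (δ * q) - s ^ 3 * k * (δ * q) ^ 2
        + δ ^ 3 * (s ^ 4 * k ^ 2 * q ^ 3 / (1 + s * k * (δ * q))) := by
    intro q hq
    obtain ⟨D, hD⟩ : ∃ D, D = 1 + s * k * (δ * q) := ⟨_, rfl⟩
    rw [← hD] at hq ⊢
    field_simp
    rw [hD]
    ring
  rw [key _ h]
  generalize s ^ 4 * k ^ 2 * ((e * δ ^ 2 * ρ ^ 2 - 1) * (ρ * (α * k + β * s) + δ * κ)) ^ 3 /
    (1 + s * k * (δ * ((e * δ ^ 2 * ρ ^ 2 - 1) * (ρ * (α * k + β * s) + δ * κ)))) = U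
  generalize corrA α β k s = A
  generalize corrB α β k s = B
  generalize α * k + β * s = l
  ring

lemma exists_bound_and_lipschitz {E : Type*} [NormedAddCommGroup E] [NormedSpace ℝ E]
    {f : E → ℝ} {S : Set E} (hS : IsCompact S) (hc : Convex ℝ S) (hf : ContDiffOn ℝ 1 f S) :
    ∃ C : ℝ, 0 < C ∧ (∀ x ∈ S, |f x| ≤ C) ∧ ∀ x ∈ S, ∀ y ∈ S, |f x - f y| ≤ C * dist x y := by
  obtain ⟨K, hK⟩ := (hf.locallyLipschitzOn hc).exists_lipschitzOnWith_of_compact hS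
  obtain ⟨C, hC⟩ := hS.exists_bound_of_continuousOn hf.continuousOn
  refine ⟨max C K + 1, ?_, fun x hx => ?_, fun x hx y hy => ?_⟩
  · have := le_max_right C K
    have := K.coe_nonneg
    linarith
  · have := hC x hx
    have := le_max_left C K
    rw [Real.norm_eq_abs] at *
    linarith
  · have h := hK.dist_le_mul x hx y hy
    rw [Real.dist_eq] at h
    have := le_max_right C K
    exact h.trans (mul_le_mul_of_nonneg_right (by linarith) dist_nonneg)

lemma abs_damping_le {e α β c k s r : ℝ} (he : e ∈ Icc (0 : ℝ) 1) (hα : |α| ≤ 1) (hβ : |β| ≤ 1)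
    (hk : |k| ≤ 1) (hs : |s| ≤ 1) (hr : |r| ≤ 1) :
    |damping e α β c k s r| ≤ 2 * |r| + |c| := by
  unfold damping
  have h1 : |e * r ^ 2 - 1| ≤ 1 := by
    have h2 : r ^ 2 ≤ 1 := (sq_le_one_iff_abs_le_one r).2 hr
    have h3 : e * r ^ 2 ≤ 1 := mul_le_one₀ he.2 (sq_nonneg r) h2
    have h4 : 0 ≤ e * r ^ 2 := mul_nonneg he.1 (sq_nonneg r)
    rw [abs_le]; constructor <;> linarith
  have h2 : |r * (α * k + β * s) + c| ≤ 2 * |r| + |c| := by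
    have h3 : |α * k + β * s| ≤ 2 := by
      have := abs_add_le (α * k) (β * s)
      rw [abs_mul, abs_mul] at this
      have := mul_le_one₀ hα (abs_nonneg k) hk
      have := mul_le_one₀ hβ (abs_nonneg s) hs
      linarith
    calc |r * (α * k + β * s) + c| ≤ |r * (α * k + β * s)| + |c| := abs_add_le _ _
      _ = |r| * |α * k + β * s| + |c| := by rw [abs_mul]
      _ ≤ |r| * 2 + |c| := by gcongr
      _ = _ := by ring
  rw [abs_mul]
  calc _ ≤ 1 * (2 * |r| + |c|) := mul_le_mul h1 h2 (abs_nonneg _) zero_le_one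
    _ = _ := one_mul _

lemma one_sub_le_one_add {k s q : ℝ} (hk : |k| ≤ 1) (hs : |s| ≤ 1) :
    1 - |q| ≤ 1 + s * k * q := by
  have h : |s * k * q| ≤ |q| := by
    rw [abs_mul, abs_mul]
    have := mul_le_one₀ hs (abs_nonneg k) hk
    exact mul_le_of_le_one_left (abs_nonneg _) this
  have := neg_abs_le (s * k * q)
  linarith

lemma remainder_denom_pos {e α β κ k s δ ρ : ℝ} (he : e ∈ Icc (0 : ℝ) 1) (hα : |α| ≤ 1)
    (hβ : |β| ≤ 1) (hκ : |κ| ≤ 1) (hk : |k| ≤ 1) (hs : |s| ≤ 1) (hδ : δ ∈ Icc (0 : ℝ) (1 / 20))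
    (hρ : ρ ∈ Icc (0 : ℝ) 4) : 0 < 1 + s * k * damping e α β (δ ^ 2 * κ) k s (δ * ρ) := by
  have hδρ : |δ * ρ| ≤ 1 / 5 := by
    rw [abs_of_nonneg (mul_nonneg hδ.1 hρ.1)]
    calc δ * ρ ≤ 1 / 20 * 4 := mul_le_mul hδ.2 hρ.2 hρ.1 (by norm_num)
      _ = _ := by norm_num
  have hδκ : |δ ^ 2 * κ| ≤ 1 / 20 := by
    rw [abs_mul, abs_of_nonneg (sq_nonneg δ)]
    calc δ ^ 2 * |κ| ≤ (1 / 20) ^ 2 * 1 :=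
          mul_le_mul (pow_le_pow_left₀ hδ.1 hδ.2 2) hκ (abs_nonneg κ) (by norm_num)
      _ ≤ _ := by norm_num
  have hq := abs_damping_le (c := δ ^ 2 * κ) (r := δ * ρ) he hα hβ hk hs (by linarith)
  have := one_sub_le_one_add (q := damping e α β (δ ^ 2 * κ) k s (δ * ρ)) hk hs
  linarith

/-- The box of values of `(ρ, e, α, β, κ, k, s, δ)` on which `remainder` is controlled. -/
def paramBox : Set (ℝ × ℝ × ℝ × ℝ × ℝ × ℝ × ℝ × ℝ) :=
  Icc (0, 0, -1, -1, -1, -1, -1, 0) (4, 1, 1, 1, 1, 1, 1, 1 / 20)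

lemma isCompact_paramBox : IsCompact paramBox := isCompact_Icc

lemma convex_paramBox : Convex ℝ paramBox := convex_Icc _ _

lemma mk_mem_paramBox {e α β κ k s δ ρ : ℝ} (he : e ∈ Icc (0 : ℝ) 1) (hα : |α| ≤ 1)
    (hβ : |β| ≤ 1) (hκ : |κ| ≤ 1) (hk : |k| ≤ 1) (hs : |s| ≤ 1) (hδ : δ ∈ Icc (0 : ℝ) (1 / 20))
    (hρ : ρ ∈ Icc (0 : ℝ) 4) : (ρ, e, α, β, κ, k, s, δ) ∈ paramBox := by
  rw [abs_le] at hα hβ hκ hk hs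
  exact ⟨⟨hρ.1, he.1, hα.1, hβ.1, hκ.1, hk.1, hs.1, hδ.1⟩,
    ⟨hρ.2, he.2, hα.2, hβ.2, hκ.2, hk.2, hs.2, hδ.2⟩⟩

lemma contDiffOn_remainder : ContDiffOn ℝ 1
    (fun x : ℝ × ℝ × ℝ × ℝ × ℝ × ℝ × ℝ × ℝ =>
      remainder x.2.1 x.2.2.1 x.2.2.2.1 x.2.2.2.2.1 x.2.2.2.2.2.1 x.2.2.2.2.2.2.1
        x.2.2.2.2.2.2.2 x.1) paramBox := by
  unfold remainder corrB corrA
  refine ContDiffOn.add (by fun_prop) (ContDiffOn.mul (by fun_prop)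
    (ContDiffOn.add (by fun_prop) (ContDiffOn.div (by fun_prop) (by fun_prop) ?_)))
  rintro ⟨ρ, e, α, β, κ, k, s, δ⟩
    ⟨⟨h1, h2, h3, h4, h5, h6, h7, h8⟩, g1, g2, g3, g4, g5, g6, g7, g8⟩
  have := remainder_denom_pos ⟨h2, g2⟩ (abs_le.2 ⟨h3, g3⟩) (abs_le.2 ⟨h4, g4⟩)
    (abs_le.2 ⟨h5, g5⟩) (abs_le.2 ⟨h6, g6⟩) (abs_le.2 ⟨h7, g7⟩) ⟨h8, g8⟩ ⟨h1, g1⟩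
  rw [damping_scale] at this
  exact this.ne'

/-- By compactness, the remainder is bounded, and Lipschitz in the radius, uniformly in all the
parameters. -/
lemma exists_bound_remainder : ∃ C : ℝ, 0 < C ∧
    ∀ e α β κ k s δ : ℝ, e ∈ Icc (0 : ℝ) 1 → |α| ≤ 1 → |β| ≤ 1 → |κ| ≤ 1 → |k| ≤ 1 → |s| ≤ 1 →
      δ ∈ Icc (0 : ℝ) (1 / 20) → ∀ ρ ∈ Icc (0 : ℝ) 4,
      |remainder e α β κ k s δ ρ| ≤ C ∧ ∀ ρ' ∈ Icc (0 : ℝ) 4,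
        |remainder e α β κ k s δ ρ' - remainder e α β κ k s δ ρ| ≤ C * |ρ' - ρ| := by
  obtain ⟨C, hC, hb, hl⟩ := exists_bound_and_lipschitz isCompact_paramBox convex_paramBox
    contDiffOn_remainder
  refine ⟨C, hC, fun e α β κ k s δ he hα hβ hκ hk hs hδ ρ hρ => ?_⟩
  have hmem : ∀ ρ ∈ Icc (0 : ℝ) 4, (ρ, e, α, β, κ, k, s, δ) ∈ paramBox := fun ρ hρ =>
    mk_mem_paramBox he hα hβ hκ hk hs hδ hρ
  refine ⟨hb (ρ, e, α, β, κ, k, s, δ) (hmem ρ hρ), fun ρ' hρ' => ?_⟩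
  have h := hl (ρ', e, α, β, κ, k, s, δ) (hmem ρ' hρ') (ρ, e, α, β, κ, k, s, δ) (hmem ρ hρ)
  rwa [show dist (ρ', e, α, β, κ, k, s, δ) (ρ, e, α, β, κ, k, s, δ) = |ρ' - ρ| by
    rw [Prod.dist_eq, dist_self, Real.dist_eq, max_eq_left (abs_nonneg _)]] at h

/-! ### The derivative of the corrected logarithmic radius near balance -/

/-- The parameters `e`, `α`, `β` are in their natural ranges, `c` has the sign opposite to `α β`,
and the radius `d` at which the terms `-c / 2` and `-(α β / 8) r²` of `lyapRate` balance is
smaller than `η |α β|`. -/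
structure IsSmall (η e α β c d : ℝ) : Prop where
  e_mem : e ∈ Icc (0 : ℝ) 1
  abs_α_le : |α| ≤ 1
  abs_β_le : |β| ≤ 1
  d_pos : 0 < d
  d_lt : d < η * |α * β|
  four_abs_c : 4 * |c| = |α * β| * d ^ 2
  neg : α * β * c < 0

namespace IsSmall
variable {η e α β c d : ℝ}

lemma abs_mul_le (h : IsSmall η e α β c d) : |α * β| ≤ 1 := by
  rw [abs_mul]; exact mul_le_one₀ h.abs_α_le (abs_nonneg β) h.abs_β_le

lemma abs_mul_pos (h : IsSmall η e α β c d) : 0 < |α * β| := by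
  refine abs_pos.2 fun h0 => ?_
  have := h.neg
  rw [h0, zero_mul] at this
  exact lt_irrefl _ this

lemma d_lt_of_le {b : ℝ} (h : IsSmall η e α β c d) (hη : η ≤ b) : d < b := by
  have h1 := h.d_lt
  have h2 := h.abs_mul_le
  have h3 := h.abs_mul_pos
  have h4 := h.d_pos
  have : η * |α * β| ≤ η := by
    have : 0 < η := by
      by_contra hη0
      nlinarith
    exact mul_le_of_le_one_right this.le h2
  linarith

lemma abs_c_le (h : IsSmall η e α β c d) (hη : η ≤ 1) : |c| ≤ d / 4 := by
  have h1 := h.four_abs_c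
  have h2 := h.abs_mul_le
  have h3 := h.d_lt_of_le hη
  have h4 := h.d_pos
  have : |α * β| * d ^ 2 ≤ 1 * d ^ 2 := by gcongr
  nlinarith

end IsSmall

/-- A constant `η` for which smallness of the parameters makes the remainder negligible: `α β`
times the derivative of `lyap` along orbits is positive for `r ≤ 3 d / 5`, negative for
`3 d / 2 ≤ r ≤ 4 d`, and strictly decreasing in `r` for `d / 4 ≤ r ≤ 4 d`. -/
structure IsThreshold (η : ℝ) : Prop where
  pos : 0 < η
  le : η ≤ 1 / 2000
  rate_inner : ∀ {e α β c d k s : ℝ}, IsSmall η e α β c d → |k| ≤ 1 → |s| ≤ 1 →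
    ∀ r, 0 ≤ r → r ≤ 3 / 5 * d → 0 < α * β * lyapRate e α β c k s r
  rate_outer : ∀ {e α β c d k s : ℝ}, IsSmall η e α β c d → |k| ≤ 1 → |s| ≤ 1 →
    ∀ r, 3 / 2 * d ≤ r → r ≤ 4 * d → α * β * lyapRate e α β c k s r < 0
  rate_anti : ∀ {e α β c d k s : ℝ}, IsSmall η e α β c d → |k| ≤ 1 → |s| ≤ 1 →
    ∀ r r', d / 4 ≤ r → r < r' → r' ≤ 4 * d →
      α * β * (lyapRate e α β c k s r' - lyapRate e α β c k s r) < 0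

lemma exists_isThreshold : ∃ η : ℝ, IsThreshold η := by
  suffices H : ∃ η : ℝ, 0 < η ∧ η ≤ 1 / 2000 ∧
      ∀ e α β c d : ℝ, IsSmall η e α β c d → ∀ k s : ℝ, |k| ≤ 1 → |s| ≤ 1 →
        (∀ r, 0 ≤ r → r ≤ 3 / 5 * d → 0 < α * β * lyapRate e α β c k s r) ∧
        (∀ r, 3 / 2 * d ≤ r → r ≤ 4 * d → α * β * lyapRate e α β c k s r < 0) ∧
        (∀ r r', d / 4 ≤ r → r < r' → r' ≤ 4 * d →
          α * β * (lyapRate e α β c k s r' - lyapRate e α β c k s r) < 0) by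
    obtain ⟨η, h0, h1, h⟩ := H
    exact ⟨η, h0, h1, fun hp hk hs => (h _ _ _ _ _ hp _ _ hk hs).1,
      fun hp hk hs => (h _ _ _ _ _ hp _ _ hk hs).2.1,
      fun hp hk hs => (h _ _ _ _ _ hp _ _ hk hs).2.2⟩
  obtain ⟨C, hC, hb⟩ := exists_bound_remainder
  refine ⟨min (1 / 2000) (1 / (100 * C)), by positivity, min_le_left _ _,
    fun e α β c d h k s hk hs => ?_⟩
  have hd := h.d_pos
  have hd1 : d < 1 / 2000 := h.d_lt_of_le (min_le_left _ _)
  have hm := h.abs_mul_pos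
  have hm1 := h.abs_mul_le
  set m := |α * β| with hm_def
  have hm2 : (α * β) * (α * β) = m ^ 2 := by rw [hm_def, sq_abs]; ring
  have hdC : d * C ≤ m / 100 := by
    have h1 : d ≤ 1 / (100 * C) * m :=
      h.d_lt.le.trans (mul_le_mul_of_nonneg_right (min_le_right _ _) hm.le)
    calc d * C ≤ 1 / (100 * C) * m * C := mul_le_mul_of_nonneg_right h1 hC.le
      _ = m / 100 := by field_simp
  -- the scaling `c = d² κ`, `r = d ρ` of `lyapRate_eq`
  obtain ⟨κ, rfl⟩ : ∃ κ, c = d ^ 2 * κ := ⟨c / d ^ 2, by field_simp⟩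
  have hκ : |κ| = m / 4 := by
    have h1 := h.four_abs_c
    rw [abs_mul, abs_of_nonneg (sq_nonneg d)] at h1
    have h2 : d ^ 2 * (4 * |κ|) = d ^ 2 * m := by rw [hm_def]; linarith
    have := mul_left_cancel₀ (by positivity) h2
    linarith
  have hκm : α * β * κ = -(m ^ 2 / 4) := by
    have h1 : α * β * κ < 0 := by
      have h1 := h.neg
      by_contra h2
      have := mul_nonneg (sq_nonneg d) (not_lt.1 h2)
      linarith
    have h2 : |α * β * κ| = m * (m / 4) := by rw [abs_mul, hκ]
    rw [abs_of_neg h1] at h2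
    linarith
  have hb' := hb e α β κ k s d h.e_mem h.abs_α_le h.abs_β_le (by rw [hκ]; linarith) hk hs
    ⟨hd.le, by linarith⟩
  have hrate : ∀ ρ ∈ Icc (0 : ℝ) 4, α * β * lyapRate e α β (d ^ 2 * κ) k s (d * ρ) =
      d ^ 2 * (m ^ 2 / 8 * (1 - ρ ^ 2) + α * β * (d * remainder e α β κ k s d ρ)) := by
    intro ρ hρ
    rw [lyapRate_eq (remainder_denom_pos h.e_mem h.abs_α_le h.abs_β_le (by rw [hκ]; linarith)
      hk hs ⟨hd.le, by linarith⟩ hρ).ne']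
    linear_combination (-(d ^ 2) / 2) * hκm - d ^ 2 * ρ ^ 2 / 8 * hm2
  have hsmall : ∀ x B : ℝ, |x| ≤ C * B → 0 ≤ B → |α * β * (d * x)| ≤ m ^ 2 / 100 * B := by
    intro x B hx hB
    rw [abs_mul (α * β), abs_mul d, abs_of_pos hd, ← hm_def]
    calc m * (d * |x|) ≤ m * (d * (C * B)) := by gcongr
      _ = m * (d * C) * B := by ring
      _ ≤ m * (m / 100) * B := by gcongr
      _ = _ := by ring
  have hm3 : 0 < m ^ 2 := by positivity
  have hscale : ∀ r, ∃ ρ, r = d * ρ := fun r => ⟨r / d, by field_simp⟩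
  refine ⟨fun r hr0 hr => ?_, fun r hr0 hr => ?_, fun r r' hr hrr' hr' => ?_⟩
  · obtain ⟨ρ, rfl⟩ := hscale r
    have h1 : 0 ≤ ρ := by nlinarith
    have h2 : ρ ≤ 3 / 5 := by nlinarith
    rw [hrate ρ ⟨h1, by linarith⟩]
    have h3 := hsmall _ 1 (by simpa using (hb' ρ ⟨h1, by linarith⟩).1) zero_le_one
    have h4 := neg_abs_le (α * β * (d * remainder e α β κ k s d ρ))
    refine mul_pos (by positivity) ?_
    nlinarith [mul_nonneg hm3.le (show 0 ≤ (3 / 5) ^ 2 - ρ ^ 2 by nlinarith)]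
  · obtain ⟨ρ, rfl⟩ := hscale r
    have h1 : 3 / 2 ≤ ρ := by nlinarith
    have h2 : ρ ≤ 4 := by nlinarith
    rw [hrate ρ ⟨by linarith, h2⟩]
    have h3 := hsmall _ 1 (by simpa using (hb' ρ ⟨by linarith, h2⟩).1) zero_le_one
    have h4 := le_abs_self (α * β * (d * remainder e α β κ k s d ρ))
    refine mul_neg_of_pos_of_neg (by positivity) ?_
    nlinarith [mul_nonneg hm3.le (show 0 ≤ ρ ^ 2 - (3 / 2) ^ 2 by nlinarith)]
  · obtain ⟨ρ, rfl⟩ := hscale r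
    obtain ⟨ρ', rfl⟩ := hscale r'
    have h1 : 1 / 4 ≤ ρ := by nlinarith
    have h2 : ρ < ρ' := by nlinarith
    have h3 : ρ' ≤ 4 := by nlinarith
    have m1 : ρ ∈ Icc (0 : ℝ) 4 := ⟨by linarith, by linarith⟩
    have m2 : ρ' ∈ Icc (0 : ℝ) 4 := ⟨by linarith, by linarith⟩
    rw [mul_sub, hrate ρ m1, hrate ρ' m2]
    have h4 := hsmall _ _ ((hb' ρ m1).2 ρ' m2) (abs_nonneg _)
    rw [abs_of_pos (show 0 < ρ' - ρ by linarith)] at h4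
    have h5 := le_abs_self (α * β * (d * (remainder e α β κ k s d ρ' - remainder e α β κ k s d ρ)))
    have h6 : 0 < m ^ 2 * (ρ' - ρ) := mul_pos hm3 (by linarith)
    rw [← mul_sub]
    refine mul_neg_of_pos_of_neg (by positivity) ?_
    nlinarith [mul_nonneg h6.le (show 0 ≤ ρ' + ρ - 1 / 2 by linarith)]

/-! ### Global flow of the clamped polar equation -/

/-- A bounded, globally Lipschitz time-dependent vector field has global solutions: the
Picard-Lindelöf theorem applies on every interval `[-n, n]`, and the local solutions agree by
uniqueness. -/
theorem exists_global_solution {E : Type*} [NormedAddCommGroup E] [NormedSpace ℝ E]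
    [CompleteSpace E] {v : ℝ → E → E} {K M : ℝ≥0} (hv : ∀ t, LipschitzWith K (v t))
    (hc : ∀ x, Continuous fun t => v t x) (hM : ∀ t x, ‖v t x‖ ≤ M) (x₀ : E) :
    ∃ f : ℝ → E, f 0 = x₀ ∧ ∀ t, HasDerivAt f (v t (f t)) t := by
  have hloc : ∀ n : ℕ, ∃ f : ℝ → E, f 0 = x₀ ∧
      ∀ t ∈ Ioo (-(n + 1 : ℝ)) (n + 1), HasDerivAt f (v t (f t)) t := by
    intro n
    have h0 : (0 : ℝ) ∈ Icc (-(n + 1 : ℝ)) (n + 1) := ⟨by linarith [n.cast_nonneg (α := ℝ)],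
      by linarith [n.cast_nonneg (α := ℝ)]⟩
    have hPL : IsPicardLindelof v (⟨0, h0⟩ : Icc (-(n + 1 : ℝ)) (n + 1)) x₀
        (M * (n + 1)) 0 M K :=
      { lipschitzOnWith := fun t _ => (hv t).lipschitzOnWith
        continuousOn := fun x _ => (hc x).continuousOn
        norm_le := fun t _ x _ => hM t x
        mul_max_le := by simp }
    obtain ⟨f, hf0, hf⟩ := hPL.exists_eq_forall_mem_Icc_hasDerivWithinAt₀
    exact ⟨f, hf0, fun t ht =>
      (hf t (Ioo_subset_Icc_self ht)).hasDerivAt (Icc_mem_nhds ht.1 ht.2)⟩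
  choose f hf0 hf using hloc
  have hagree : ∀ m n : ℕ, m ≤ n → ∀ t ∈ Ioo (-(m + 1 : ℝ)) (m + 1), f m t = f n t := by
    intro m n hmn t ht
    have hmn' : (m : ℝ) ≤ n := by exact_mod_cast hmn
    refine ODE_solution_unique_of_mem_Ioo (v := v) (s := fun _ => univ) (K := K) (t₀ := 0)
      (fun t _ => (hv t).lipschitzOnWith) ?_
      (fun t ht => ⟨hf m t ht, mem_univ _⟩) (fun t ht => ⟨hf n t ⟨?_, ?_⟩, mem_univ _⟩)
      (by rw [hf0, hf0]) ht
    · constructor <;> linarith [m.cast_nonneg (α := ℝ)]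
    · linarith [ht.1]
    · linarith [ht.2]
  refine ⟨fun t => f ⌈|t|⌉₊ t, hf0 _, fun t => ?_⟩
  obtain ⟨n, hn⟩ := exists_nat_gt (|t| + 1)
  have hloc : ∀ s : ℝ, |s| < n → f ⌈|s|⌉₊ s = f n s := fun s hs => by
    refine hagree _ _ (Nat.ceil_le.2 hs.le) s ?_
    rw [mem_Ioo, ← abs_lt]
    exact (Nat.le_ceil _).trans_lt (lt_add_one _)
  have htn : |t| < n := by linarith
  have hd := hf n t (abs_lt.1 (by linarith))
  rw [← hloc t htn] at hd
  refine hd.congr_of_eventuallyEq ?_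
  filter_upwards [(continuous_abs.tendsto t).eventually_lt_const htn] with s hs
  exact hloc s hs

/-- The point of `[a, b]` closest to `x`. -/
noncomputable def clamp (a b x : ℝ) : ℝ := max a (min b x)

lemma clamp_mem {a b : ℝ} (h : a ≤ b) (x : ℝ) : clamp a b x ∈ Icc a b :=
  ⟨le_max_left _ _, max_le h (min_le_left _ _)⟩

lemma clamp_of_mem {a b x : ℝ} (h : x ∈ Icc a b) : clamp a b x = x := by
  rw [clamp, min_eq_right h.2, max_eq_right h.1]

lemma lipschitzWith_clamp (a b : ℝ) : LipschitzWith 1 (clamp a b) :=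
  (LipschitzWith.id.const_min b).const_max a

lemma abs_clamp_le {b : ℝ} (hb : 0 ≤ b) (x : ℝ) : |clamp 0 b x| ≤ |x| := by
  rw [abs_of_nonneg (clamp_mem hb x).1]
  exact max_le (abs_nonneg x) ((min_le_right _ _).trans (le_abs_self x))

/-- The box of values of `(r, e, α, β, c, k, s)` to which the polar equation is restricted. -/
def fieldBox : Set (ℝ × ℝ × ℝ × ℝ × ℝ × ℝ × ℝ) :=
  Icc (0, 0, -1, -1, -(1 / 200), -1, -1) (1 / 200, 1, 1, 1, 1 / 200, 1, 1)

lemma isCompact_fieldBox : IsCompact fieldBox := isCompact_Icc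

lemma convex_fieldBox : Convex ℝ fieldBox := convex_Icc _ _

lemma abs_damping_le_of_small {e α β c k s r : ℝ} (he : e ∈ Icc (0 : ℝ) 1) (hα : |α| ≤ 1)
    (hβ : |β| ≤ 1) (hk : |k| ≤ 1) (hs : |s| ≤ 1) (hc : |c| ≤ 1 / 200) (hr : |r| ≤ 1 / 200) :
    |damping e α β c k s r| ≤ 3 / 200 := by
  have := abs_damping_le (c := c) (r := r) he hα hβ hk hs (by linarith)
  linarith

lemma angular_speed_ge {e α β c k s r : ℝ} (he : e ∈ Icc (0 : ℝ) 1) (hα : |α| ≤ 1)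
    (hβ : |β| ≤ 1) (hk : |k| ≤ 1) (hs : |s| ≤ 1) (hc : |c| ≤ 1 / 200) (hr : |r| ≤ 1 / 200) :
    197 / 200 ≤ 1 + s * k * damping e α β c k s r := by
  have := abs_damping_le_of_small he hα hβ hk hs hc hr
  have := one_sub_le_one_add (q := damping e α β c k s r) hk hs
  linarith

lemma abs_radialRate_le {e α β c k s r : ℝ} (he : e ∈ Icc (0 : ℝ) 1) (hα : |α| ≤ 1)
    (hβ : |β| ≤ 1) (hk : |k| ≤ 1) (hs : |s| ≤ 1) (hc : |c| ≤ 1 / 200) (hr : |r| ≤ 1 / 200) :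
    |radialRate e α β c k s r| ≤ 1 / 60 := by
  have h1 := abs_damping_le_of_small he hα hβ hk hs hc hr
  have h2 := angular_speed_ge he hα hβ hk hs hc hr
  unfold radialRate
  rw [abs_div, abs_mul, abs_of_nonneg (sq_nonneg s),
    abs_of_pos (show 0 < 1 + s * k * damping e α β c k s r by linarith),
    div_le_iff₀ (by linarith)]
  have h3 : s ^ 2 ≤ 1 := (sq_le_one_iff_abs_le_one s).2 hs
  have := mul_le_mul h3 h1 (abs_nonneg _) zero_le_one
  linarith

lemma contDiffOn_radial : ContDiffOn ℝ 1
    (fun z : ℝ × ℝ × ℝ × ℝ × ℝ × ℝ × ℝ => z.1 * radialRate z.2.1 z.2.2.1 z.2.2.2.1 z.2.2.2.2.1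
      z.2.2.2.2.2.1 z.2.2.2.2.2.2 z.1) fieldBox := by
  unfold radialRate
  have hq : ContDiff ℝ 1 (fun z : ℝ × ℝ × ℝ × ℝ × ℝ × ℝ × ℝ => damping z.2.1 z.2.2.1 z.2.2.2.1
      z.2.2.2.2.1 z.2.2.2.2.2.1 z.2.2.2.2.2.2 z.1) := by
    unfold damping; fun_prop
  refine ContDiffOn.mul (by fun_prop) (ContDiffOn.div (by fun_prop) (by fun_prop) ?_)
  rintro ⟨r, e, α, β, c, k, s⟩ ⟨⟨h1, h2, h3, h4, h5, h6, h7⟩, g1, g2, g3, g4, g5, g6, g7⟩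
  have := angular_speed_ge (r := r) ⟨h2, g2⟩ (abs_le.2 ⟨h3, g3⟩) (abs_le.2 ⟨h4, g4⟩)
    (abs_le.2 ⟨h6, g6⟩) (abs_le.2 ⟨h7, g7⟩) (abs_le.2 ⟨h5, g5⟩)
    (abs_le.2 ⟨(by norm_num : -(1 / 200 : ℝ) ≤ 0).trans h1, g1⟩)
  exact (lt_of_lt_of_le (by norm_num) this).ne'

/-- The right-hand side `r ↦ r * radialRate … r` of the polar equation with parameters
`p = (e, α, β, c)`, with all variables clamped to `fieldBox`. It is bounded and globally
Lipschitz, and agrees with the original equation on the region of interest. -/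
noncomputable def clampedField (θ r : ℝ) (p : ℝ × ℝ × ℝ × ℝ) : ℝ :=
  clamp 0 (1 / 200) r * radialRate (clamp 0 1 p.1) (clamp (-1) 1 p.2.1) (clamp (-1) 1 p.2.2.1)
    (clamp (-(1 / 200)) (1 / 200) p.2.2.2) (cos θ) (sin θ) (clamp 0 (1 / 200) r)

/-- The point of `fieldBox` at which `clampedField` evaluates the polar equation. -/
noncomputable def clampPoint (θ : ℝ) (x : ℝ × ℝ × ℝ × ℝ × ℝ) : ℝ × ℝ × ℝ × ℝ × ℝ × ℝ × ℝ :=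
  (clamp 0 (1 / 200) x.1, clamp 0 1 x.2.1, clamp (-1) 1 x.2.2.1, clamp (-1) 1 x.2.2.2.1,
    clamp (-(1 / 200)) (1 / 200) x.2.2.2.2, cos θ, sin θ)

lemma clampPoint_mem (θ : ℝ) (x : ℝ × ℝ × ℝ × ℝ × ℝ) : clampPoint θ x ∈ fieldBox := by
  have h1 := clamp_mem (a := 0) (b := 1 / 200) (by norm_num) x.1
  have h2 := clamp_mem (a := 0) (b := 1) (by norm_num) x.2.1
  have h3 := clamp_mem (a := -1) (b := 1) (by norm_num) x.2.2.1
  have h4 := clamp_mem (a := -1) (b := 1) (by norm_num) x.2.2.2.1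
  have h5 := clamp_mem (a := -(1 / 200)) (b := 1 / 200) (by norm_num) x.2.2.2.2
  exact ⟨⟨h1.1, h2.1, h3.1, h4.1, h5.1, neg_one_le_cos θ, neg_one_le_sin θ⟩,
    ⟨h1.2, h2.2, h3.2, h4.2, h5.2, cos_le_one θ, sin_le_one θ⟩⟩

lemma continuous_clampPoint (x : ℝ × ℝ × ℝ × ℝ × ℝ) : Continuous fun θ => clampPoint θ x := by
  unfold clampPoint; fun_prop

lemma dist_clampPoint_le (θ : ℝ) (x y : ℝ × ℝ × ℝ × ℝ × ℝ) :
    dist (clampPoint θ x) (clampPoint θ y) ≤ dist x y := by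
  have h (a b : ℝ) (u v : ℝ) : dist (clamp a b u) (clamp a b v) ≤ dist u v := by
    simpa using (lipschitzWith_clamp a b).dist_le_mul u v
  simp only [clampPoint, Prod.dist_eq, dist_self]
  refine max_le_max (h _ _ _ _) (max_le_max (h _ _ _ _) (max_le_max (h _ _ _ _)
    (max_le_max (h _ _ _ _) ?_)))
  exact max_le (h _ _ _ _) dist_nonneg

lemma continuous_clampedField (r : ℝ) (p : ℝ × ℝ × ℝ × ℝ) :
    Continuous fun θ => clampedField θ r p :=
  contDiffOn_radial.continuousOn.comp_continuous (continuous_clampPoint (r, p))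
    fun θ => clampPoint_mem θ (r, p)

lemma exists_bound_clampedField : ∃ C : ℝ≥0, (∀ θ r p, |clampedField θ r p| ≤ C) ∧
    ∀ θ r p r' p', dist (clampedField θ r p) (clampedField θ r' p') ≤ C * dist (r, p) (r', p') := by
  obtain ⟨C, hC, hb, hl⟩ := exists_bound_and_lipschitz isCompact_fieldBox convex_fieldBox
    contDiffOn_radial
  refine ⟨⟨C, hC.le⟩, fun θ r p => hb _ (clampPoint_mem θ (r, p)), fun θ r p r' p' => ?_⟩
  exact (hl _ (clampPoint_mem θ (r, p)) _ (clampPoint_mem θ (r', p'))).trans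
    (mul_le_mul_of_nonneg_left (dist_clampPoint_le θ _ _) hC.le)

lemma exists_lipschitz_clampedField (p : ℝ × ℝ × ℝ × ℝ) :
    ∃ K : ℝ≥0, ∀ θ, LipschitzWith K fun r => clampedField θ r p := by
  obtain ⟨C, -, hl⟩ := exists_bound_clampedField
  refine ⟨C, fun θ => LipschitzWith.of_dist_le_mul fun r r' => ?_⟩
  simpa [Prod.dist_eq] using hl θ r p r' p

lemma clampedField_unique {p : ℝ × ℝ × ℝ × ℝ} {R R' : ℝ → ℝ} {θ₀ : ℝ}
    (hR : ∀ θ, HasDerivAt R (clampedField θ (R θ) p) θ)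
    (hR' : ∀ θ, HasDerivAt R' (clampedField θ (R' θ) p) θ) (h : R θ₀ = R' θ₀) : R = R' := by
  obtain ⟨K, hK⟩ := exists_lipschitz_clampedField p
  exact ODE_solution_unique_univ (v := fun θ r => clampedField θ r p) (s := fun _ => univ)
    (fun θ => (hK θ).lipschitzOnWith) (fun θ => ⟨hR θ, mem_univ _⟩)
    (fun θ => ⟨hR' θ, mem_univ _⟩) h

/-- The flow of the clamped polar equation from angle `0`. The parameters are carried along as
constant components of the state, so that continuity in the initial state includes continuity
in the parameters. -/
theorem exists_flow : ∃ F : ℝ × ℝ × ℝ × ℝ × ℝ → ℝ → ℝ, (∀ x, F x 0 = x.1) ∧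
    (∀ x θ, HasDerivAt (F x) (clampedField θ (F x θ) x.2) θ) ∧
    ∀ θ, 0 ≤ θ → Continuous fun x => F x θ := by
  obtain ⟨C, hb, hl⟩ := exists_bound_clampedField
  let v : ℝ → ℝ × ℝ × ℝ × ℝ × ℝ → ℝ × ℝ × ℝ × ℝ × ℝ := fun θ x => (clampedField θ x.1 x.2, 0)
  have hv : ∀ θ, LipschitzWith C (v θ) := fun θ => LipschitzWith.of_dist_le_mul fun x y => by
    rw [Prod.dist_eq, dist_self, max_eq_left dist_nonneg]
    exact hl θ _ _ _ _
  have hM : ∀ θ x, ‖v θ x‖ ≤ C := fun θ x => by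
    rw [Prod.norm_def, norm_zero, max_eq_left (norm_nonneg _)]
    exact hb θ _ _
  choose G hG0 hG using exists_global_solution hv
    (fun x => (continuous_clampedField x.1 x.2).prodMk continuous_const) hM
  have hconst : ∀ x θ, (G x θ).2 = x.2 := fun x θ => by
    have h1 : ∀ θ, HasDerivAt (fun θ => (G x θ).2) 0 θ := fun θ =>
      (ContinuousLinearMap.snd ℝ ℝ (ℝ × ℝ × ℝ × ℝ)).hasFDerivAt.comp_hasDerivAt θ (hG x θ)
    have h2 := is_const_of_deriv_eq_zero (fun θ => (h1 θ).differentiableAt)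
      (fun θ => (h1 θ).deriv) θ 0
    rw [h2, hG0]
  refine ⟨fun x θ => (G x θ).1, fun x => by simp [hG0], fun x θ => ?_, fun θ hθ => ?_⟩
  · have h1 := (ContinuousLinearMap.fst ℝ ℝ (ℝ × ℝ × ℝ × ℝ)).hasFDerivAt.comp_hasDerivAt θ (hG x θ)
    rw [← hconst x θ]
    exact h1
  · have hLip : LipschitzWith (exp (C * θ)).toNNReal fun x => G x θ :=
      LipschitzWith.of_dist_le_mul fun x y => by
        have h1 := dist_le_of_trajectories_ODE (a := 0) (b := θ) hv
          (fun t _ => (hG x t).continuousAt.continuousWithinAt)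
          (fun t _ => (hG x t).hasDerivWithinAt)
          (fun t _ => (hG y t).continuousAt.continuousWithinAt)
          (fun t _ => (hG y t).hasDerivWithinAt) le_rfl θ ⟨hθ, le_rfl⟩
        rw [hG0, hG0, sub_zero] at h1
        rw [Real.coe_toNNReal _ (exp_pos _).le, mul_comm]
        exact h1
    exact continuous_fst.comp hLip.continuous

/-! ### The return map -/

lemma clampedField_zero (θ : ℝ) (p : ℝ × ℝ × ℝ × ℝ) : clampedField θ 0 p = 0 := by
  rw [clampedField, clamp_of_mem ⟨le_rfl, by norm_num⟩, zero_mul]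

lemma clampedField_add_two_pi (θ r : ℝ) (p : ℝ × ℝ × ℝ × ℝ) :
    clampedField (θ + 2 * π) r p = clampedField θ r p := by
  rw [clampedField, cos_add_two_pi, sin_add_two_pi, clampedField]

lemma abs_clampedField_le (θ r : ℝ) (p : ℝ × ℝ × ℝ × ℝ) : |clampedField θ r p| ≤ |r| / 60 := by
  have h5 := clamp_mem (a := -(1 / 200)) (b := 1 / 200) (by norm_num) p.2.2.2
  have h1 := clamp_mem (a := 0) (b := 1 / 200) (by norm_num) r
  have h := abs_radialRate_le (clamp_mem zero_le_one p.1)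
    (abs_le.2 (clamp_mem (a := -1) (b := 1) (by norm_num) p.2.1))
    (abs_le.2 (clamp_mem (a := -1) (b := 1) (by norm_num) p.2.2.1))
    (abs_cos_le_one θ) (abs_sin_le_one θ) (abs_le.2 h5)
    (abs_le.2 ⟨(by norm_num : -(1 / 200 : ℝ) ≤ 0).trans h1.1, h1.2⟩)
  rw [clampedField, abs_mul]
  calc _ ≤ |r| * (1 / 60) :=
        mul_le_mul (abs_clamp_le (by norm_num) r) h (abs_nonneg _) (abs_nonneg _)
    _ = |r| / 60 := by ring

/-- Distinct solutions of the scalar equation never meet, so they stay ordered. -/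
lemma lt_of_clampedField {p : ℝ × ℝ × ℝ × ℝ} {R R' : ℝ → ℝ} {θ₀ : ℝ}
    (hR : ∀ θ, HasDerivAt R (clampedField θ (R θ) p) θ)
    (hR' : ∀ θ, HasDerivAt R' (clampedField θ (R' θ) p) θ) (h : R θ₀ < R' θ₀) (θ : ℝ) :
    R θ < R' θ := by
  by_contra hle
  have hc : Continuous fun θ => R' θ - R θ := by
    refine continuous_iff_continuousAt.2 fun t => ?_
    exact (hR' t).continuousAt.sub (hR t).continuousAt
  obtain ⟨t, ht⟩ := mem_range_of_exists_le_of_exists_ge hc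
    ⟨θ, show R' θ - R θ ≤ 0 by linarith⟩ ⟨θ₀, show 0 ≤ R' θ₀ - R θ₀ by linarith⟩
  have := clampedField_unique hR hR' (θ₀ := t) (by simp only at ht; linarith)
  rw [this] at h
  exact lt_irrefl _ h

lemma pos_of_clampedField {p : ℝ × ℝ × ℝ × ℝ} {R : ℝ → ℝ} {θ₀ : ℝ}
    (hR : ∀ θ, HasDerivAt R (clampedField θ (R θ) p) θ) (h : 0 < R θ₀) (θ : ℝ) : 0 < R θ :=
  lt_of_clampedField (R := fun _ => 0)
    (fun t => by rw [clampedField_zero]; exact hasDerivAt_const t 0) hR h θ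

/-- During one turn the radius changes by little more than ten percent. -/
lemma bounds_of_clampedField {p : ℝ × ℝ × ℝ × ℝ} {R : ℝ → ℝ}
    (hR : ∀ θ, HasDerivAt R (clampedField θ (R θ) p) θ) (h : 0 < R 0) {θ : ℝ}
    (hθ : θ ∈ Icc 0 (2 * π)) : 89 / 100 * R 0 ≤ R θ ∧ R θ ≤ 112 / 100 * R 0 := by
  have hpos := pos_of_clampedField hR h
  have hb : ∀ t, |clampedField t (R t) p| ≤ R t / 60 := fun t => by
    simpa [abs_of_pos (hpos t)] using abs_clampedField_le t (R t) p
  have hexp : ∀ a t : ℝ, HasDerivAt (fun t => exp (a * t)) (exp (a * t) * a) t := fun a t => by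
    simpa using ((hasDerivAt_id t).const_mul a).exp
  have h1 : Monotone fun t => R t * exp (1 / 60 * t) := by
    refine monotone_of_hasDerivAt_nonneg (fun t => (hR t).mul (hexp (1 / 60) t)) fun t => ?_
    have := (abs_le.1 (hb t)).1
    have h2 := exp_pos (1 / 60 * t)
    simp only [Pi.zero_apply]
    nlinarith
  have h2 : Antitone fun t => R t * exp (-(1 / 60) * t) := by
    refine antitone_of_hasDerivAt_nonpos (fun t => (hR t).mul (hexp (-(1 / 60)) t)) fun t => ?_
    have := (abs_le.1 (hb t)).2
    have h2 := exp_pos (-(1 / 60) * t)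
    simp only [Pi.zero_apply]
    nlinarith
  have h3 := h1 hθ.1
  have h4 := h2 hθ.1
  simp only [mul_zero, exp_zero, mul_one] at h3 h4
  -- `exp (-2π / 60) ≥ 1 - 2π / 60`, which is a little more than `0.895`
  have h5 : 89.5 / 100 ≤ exp (-(1 / 60) * θ) := by
    have := add_one_le_exp (-(1 / 60) * θ)
    have := pi_lt_d2
    have := hθ.2
    norm_num at *
    linarith
  have h6 : exp (1 / 60 * θ) * exp (-(1 / 60) * θ) = 1 := by
    rw [← exp_add]; simp
  have h7 := exp_pos (1 / 60 * θ)
  have h8 := hpos θ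
  constructor
  · have : R 0 * exp (-(1 / 60) * θ) ≤ R θ := by
      calc R 0 * exp (-(1 / 60) * θ) ≤ R θ * exp (1 / 60 * θ) * exp (-(1 / 60) * θ) := by gcongr
        _ = R θ := by rw [mul_assoc, h6, mul_one]
    nlinarith
  · nlinarith

/-- The solution of the clamped polar equation with radius `x.1` at angle `0` and parameters
`x.2`, as a function of the angle. -/
noncomputable def flow : ℝ × ℝ × ℝ × ℝ × ℝ → ℝ → ℝ := Classical.choose exists_flow

lemma flow_zero (x : ℝ × ℝ × ℝ × ℝ × ℝ) : flow x 0 = x.1 := (Classical.choose_spec exists_flow).1 x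

lemma hasDerivAt_flow (x : ℝ × ℝ × ℝ × ℝ × ℝ) (θ : ℝ) :
    HasDerivAt (flow x) (clampedField θ (flow x θ) x.2) θ :=
  (Classical.choose_spec exists_flow).2.1 x θ

/-- The Poincaré return map of the positive `x`-axis, in the rescaled radius, jointly with the
parameters. -/
noncomputable def returnMap (x : ℝ × ℝ × ℝ × ℝ × ℝ) : ℝ := flow x (2 * π)

lemma continuous_returnMap : Continuous returnMap :=
  (Classical.choose_spec exists_flow).2.2 _ two_pi_pos.le

lemma flow_add_two_pi {x : ℝ × ℝ × ℝ × ℝ × ℝ} (h : returnMap x = x.1) (θ : ℝ) :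
    flow x (θ + 2 * π) = flow x θ := by
  have h1 : ∀ θ, HasDerivAt (fun θ => flow x (θ + 2 * π))
      (clampedField θ (flow x (θ + 2 * π)) x.2) θ := fun θ => by
    have := (hasDerivAt_flow x (θ + 2 * π)).comp_add_const θ (2 * π)
    rwa [clampedField_add_two_pi] at this
  have := clampedField_unique h1 (hasDerivAt_flow x) (θ₀ := 0) (by
    rw [zero_add, flow_zero]; exact h)
  exact congrFun this θ

section
variable {η e α β c d : ℝ}

lemma IsSmall.clampedField_eq (h : IsSmall η e α β c d) (hη : IsThreshold η) {r : ℝ} (hr : 0 ≤ r)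
    (hrd : r ≤ 4 * d) (θ : ℝ) :
    clampedField θ r (e, α, β, c) = r * radialRate e α β c (cos θ) (sin θ) r := by
  have hd := h.d_lt_of_le hη.le
  have hc := h.abs_c_le (hη.le.trans (by norm_num))
  rw [clampedField, clamp_of_mem ⟨hr, by linarith⟩, clamp_of_mem h.e_mem,
    clamp_of_mem (abs_le.1 h.abs_α_le), clamp_of_mem (abs_le.1 h.abs_β_le),
    clamp_of_mem (abs_le.1 (by simp only; linarith))]

lemma lyap_zero (α β c r : ℝ) : lyap α β c 0 r = log r := by
  norm_num [lyap, corrA, corrB]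

lemma lyap_add_nat_mul_two_pi (α β c θ r : ℝ) (n : ℕ) :
    lyap α β c (θ + n * (2 * π)) r = lyap α β c θ r := by
  rw [lyap, cos_add_nat_mul_two_pi, sin_add_nat_mul_two_pi, lyap]

lemma lyap_two_pi (α β c r : ℝ) : lyap α β c (2 * π) r = log r := by
  simpa [lyap_zero] using lyap_add_nat_mul_two_pi α β c 0 r 1

/-- Two solutions in the annulus `d / 4 ≤ r ≤ 4 d` approach or leave each other strictly, when
measured by `lyap`. -/
lemma IsSmall.strictAntiOn_lyap_sub (h : IsSmall η e α β c d) (hη : IsThreshold η)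
    {R R' : ℝ → ℝ} {x y : ℝ}
    (hR : ∀ θ ∈ Icc x y, HasDerivAt R (clampedField θ (R θ) (e, α, β, c)) θ)
    (hR' : ∀ θ ∈ Icc x y, HasDerivAt R' (clampedField θ (R' θ) (e, α, β, c)) θ)
    (hlt : ∀ θ ∈ Icc x y, d / 4 ≤ R θ ∧ R θ < R' θ ∧ R' θ ≤ 4 * d) :
    StrictAntiOn (fun θ => α * β * (lyap α β c θ (R' θ) - lyap α β c θ (R θ))) (Icc x y) := by
  have hd := h.d_pos
  have hder : ∀ θ ∈ Icc x y, HasDerivAt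
      (fun θ => α * β * (lyap α β c θ (R' θ) - lyap α β c θ (R θ)))
      (α * β * (lyapRate e α β c (cos θ) (sin θ) (R' θ) -
        lyapRate e α β c (cos θ) (sin θ) (R θ))) θ := by
    intro θ hθ
    obtain ⟨h1, h2, h3⟩ := hlt θ hθ
    have d1 := hR θ hθ
    have d2 := hR' θ hθ
    rw [h.clampedField_eq hη (by linarith) (by linarith)] at d1 d2
    exact ((hasDerivAt_lyap (by linarith) d2).sub (hasDerivAt_lyap (by linarith) d1)).const_mul _
  refine strictAntiOn_of_deriv_neg (convex_Icc x y)
    (fun θ hθ => (hder θ hθ).continuousAt.continuousWithinAt) fun θ hθ => ?_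
  have hθ' := interior_subset hθ
  rw [(hder θ hθ').deriv]
  obtain ⟨h1, h2, h3⟩ := hlt θ hθ'
  exact hη.rate_anti h (abs_cos_le_one θ) (abs_sin_le_one θ) _ _ h1 h2 h3

/-- The sign of `u - v` is that of `log u - log v`; the factor `m` may have either sign. -/
lemma mul_sub_pos_of_log {m u v : ℝ} (hu : 0 < u) (hv : 0 < v) (h : 0 < m * (log u - log v)) :
    0 < m * (u - v) := by
  rcases pos_and_pos_or_neg_and_neg_of_mul_pos h with ⟨h1, h2⟩ | ⟨h1, h2⟩
  · exact mul_pos h1 (sub_pos.2 ((log_lt_log_iff hv hu).1 (sub_pos.1 h2)))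
  · exact mul_pos_of_neg_of_neg h1 (sub_neg.2 ((log_lt_log_iff hu hv).1 (sub_neg.1 h2)))

lemma IsSmall.flow_bounds (h : IsSmall η e α β c d) {r : ℝ} (hr : d / 2 ≤ r)
    {θ : ℝ} (hθ : θ ∈ Icc 0 (2 * π)) :
    89 / 100 * r ≤ flow (r, e, α, β, c) θ ∧ flow (r, e, α, β, c) θ ≤ 112 / 100 * r := by
  have := bounds_of_clampedField (hasDerivAt_flow (r, e, α, β, c))
    (by rw [flow_zero]; linarith [h.d_pos]) hθ
  rwa [flow_zero] at this

lemma IsSmall.hasDerivAt_lyap_flow (h : IsSmall η e α β c d) (hη : IsThreshold η) {r : ℝ}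
    (hr : d / 2 ≤ r) (hr' : r ≤ 2 * d) {θ : ℝ} (hθ : θ ∈ Icc 0 (2 * π)) :
    HasDerivAt (fun θ => lyap α β c θ (flow (r, e, α, β, c) θ))
      (lyapRate e α β c (cos θ) (sin θ) (flow (r, e, α, β, c) θ)) θ := by
  obtain ⟨h1, h2⟩ := h.flow_bounds hr hθ
  have hd := h.d_pos
  have := hasDerivAt_flow (r, e, α, β, c) θ
  rw [h.clampedField_eq hη (by linarith) (by linarith)] at this
  exact hasDerivAt_lyap (by linarith) this

lemma IsSmall.returnMap_half (h : IsSmall η e α β c d) (hη : IsThreshold η) :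
    0 < α * β * (returnMap (d / 2, e, α, β, c) - d / 2) := by
  have hd := h.d_pos
  have hder := fun θ (hθ : θ ∈ Icc 0 (2 * π)) =>
    (h.hasDerivAt_lyap_flow hη le_rfl (by linarith) hθ).const_mul (α * β)
  have hmono := strictMonoOn_of_deriv_pos (convex_Icc 0 (2 * π))
    (fun θ hθ => (hder θ hθ).continuousAt.continuousWithinAt) (fun θ hθ => by
      have hθ' := interior_subset hθ
      rw [(hder θ hθ').deriv]
      obtain ⟨h1, h2⟩ := h.flow_bounds le_rfl hθ'
      exact hη.rate_inner h (abs_cos_le_one θ) (abs_sin_le_one θ) _ (by linarith) (by linarith))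
  have h1 := hmono ⟨le_rfl, two_pi_pos.le⟩ ⟨two_pi_pos.le, le_rfl⟩ two_pi_pos
  simp only [lyap_zero, lyap_two_pi, flow_zero] at h1
  refine mul_sub_pos_of_log ?_ (by linarith) (by rw [returnMap]; linarith)
  have := (h.flow_bounds le_rfl ⟨two_pi_pos.le, le_rfl⟩).1
  rw [returnMap]; linarith

lemma IsSmall.returnMap_two (h : IsSmall η e α β c d) (hη : IsThreshold η) :
    α * β * (returnMap (2 * d, e, α, β, c) - 2 * d) < 0 := by
  have hd := h.d_pos
  have hder := fun θ (hθ : θ ∈ Icc 0 (2 * π)) =>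
    (h.hasDerivAt_lyap_flow hη (by linarith) le_rfl hθ).const_mul (α * β)
  have hanti := strictAntiOn_of_deriv_neg (convex_Icc 0 (2 * π))
    (fun θ hθ => (hder θ hθ).continuousAt.continuousWithinAt) (fun θ hθ => by
      have hθ' := interior_subset hθ
      rw [(hder θ hθ').deriv]
      obtain ⟨h1, h2⟩ := h.flow_bounds (r := 2 * d) (by linarith) hθ'
      exact hη.rate_outer h (abs_cos_le_one θ) (abs_sin_le_one θ) _ (by linarith) (by linarith))
  have h1 := hanti ⟨le_rfl, two_pi_pos.le⟩ ⟨two_pi_pos.le, le_rfl⟩ two_pi_pos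
  simp only [lyap_zero, lyap_two_pi, flow_zero] at h1
  have h2 := (h.flow_bounds (r := 2 * d) (by linarith) ⟨two_pi_pos.le, le_rfl⟩).1
  have := mul_sub_pos_of_log (m := α * β) (u := 2 * d) (v := returnMap (2 * d, e, α, β, c))
    (by linarith) (by rw [returnMap]; linarith) (by rw [returnMap]; linarith)
  linarith

lemma IsSmall.log_returnMap_anti (h : IsSmall η e α β c d) (hη : IsThreshold η) {r r' : ℝ}
    (hr : d / 2 ≤ r) (hrr' : r < r') (hr' : r' ≤ 2 * d) :
    α * β * (log (returnMap (r', e, α, β, c)) - log r') <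
      α * β * (log (returnMap (r, e, α, β, c)) - log r) := by
  have hd := h.d_pos
  have h1 := h.strictAntiOn_lyap_sub hη (x := 0) (y := 2 * π)
    (fun θ _ => hasDerivAt_flow (r, e, α, β, c) θ)
    (fun θ _ => hasDerivAt_flow (r', e, α, β, c) θ) (fun θ hθ => by
      obtain ⟨h1, h2⟩ := h.flow_bounds hr hθ
      obtain ⟨h3, h4⟩ := h.flow_bounds (hr.trans hrr'.le) hθ
      refine ⟨by linarith, ?_, by linarith⟩
      exact lt_of_clampedField (hasDerivAt_flow (r, e, α, β, c))
        (hasDerivAt_flow (r', e, α, β, c)) (θ₀ := 0) (by rw [flow_zero, flow_zero]; exact hrr') θ)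
  have h2 := h1 ⟨le_rfl, two_pi_pos.le⟩ ⟨two_pi_pos.le, le_rfl⟩ two_pi_pos
  simp only [lyap_zero, lyap_two_pi, flow_zero] at h2
  simp only [returnMap]
  linarith

/-- The return map has a fixed point between `d / 2` and `2 d`, and the displacement has opposite
constant signs on its two sides. -/
lemma IsSmall.exists_fixed (h : IsSmall η e α β c d) (hη : IsThreshold η) :
    ∃ ρ ∈ Ioo (d / 2) (2 * d), returnMap (ρ, e, α, β, c) = ρ ∧
      (∀ r, d / 2 ≤ r → r < ρ → 0 < α * β * (returnMap (r, e, α, β, c) - r)) ∧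
      (∀ r, ρ < r → r ≤ 2 * d → α * β * (returnMap (r, e, α, β, c) - r) < 0) := by
  have hd := h.d_pos
  have hcont : ContinuousOn (fun r => α * β * (returnMap (r, e, α, β, c) - r))
      (Icc (d / 2) (2 * d)) := by
    have := continuous_returnMap
    fun_prop
  have h1 := h.returnMap_half hη
  have h2 := h.returnMap_two hη
  obtain ⟨ρ, hρ, hρ0⟩ := intermediate_value_Ioo' (by linarith) hcont ⟨h2, h1⟩
  have hm : α * β ≠ 0 := fun h0 => by simp [h0] at h1
  have hfix : returnMap (ρ, e, α, β, c) = ρ := by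
    rcases mul_eq_zero.1 hρ0 with h3 | h3
    · exact absurd h3 hm
    · linarith
  have hpos : ∀ r, d / 2 ≤ r → 0 < returnMap (r, e, α, β, c) := fun r hr => by
    have := (h.flow_bounds hr ⟨two_pi_pos.le, le_rfl⟩).1
    rw [returnMap]; linarith
  refine ⟨ρ, hρ, hfix, fun r hr hrρ => ?_, fun r hρr hr => ?_⟩
  · have h3 := h.log_returnMap_anti hη hr hrρ hρ.2.le
    rw [hfix, sub_self, mul_zero] at h3
    exact mul_sub_pos_of_log (hpos r hr) (by linarith) h3
  · have h3 := h.log_returnMap_anti hη hρ.1.le hρr hr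
    rw [hfix, sub_self, mul_zero] at h3
    have := mul_sub_pos_of_log (m := α * β) (u := r) (v := returnMap (r, e, α, β, c))
      (by linarith [hρ.1]) (hpos r (by linarith [hρ.1])) (by linarith)
    linarith

lemma IsSmall.periodic_flow_bounds (h : IsSmall η e α β c d) {ρ : ℝ} (hρ : ρ ∈ Ioo (d / 2) (2 * d))
    (hfix : returnMap (ρ, e, α, β, c) = ρ) (θ : ℝ) :
    flow (ρ, e, α, β, c) θ ∈ Ioo (d / 4) (4 * d) := by
  have hper : Function.Periodic (flow (ρ, e, α, β, c)) (2 * π) := flow_add_two_pi hfix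
  obtain ⟨t, ht, hθt⟩ := hper.exists_mem_Ico₀ two_pi_pos θ
  obtain ⟨h1, h2⟩ := h.flow_bounds hρ.1.le (Ico_subset_Icc_self ht)
  have := h.d_pos
  rw [hθt]
  exact ⟨by linarith [hρ.1], by linarith [hρ.2]⟩

/-- Two solutions in the annulus that take up their initial values again after a common number of
turns are equal. -/
lemma IsSmall.eq_of_periodic (h : IsSmall η e α β c d) (hη : IsThreshold η) {R R' : ℝ → ℝ}
    (hR : ∀ θ, HasDerivAt R (clampedField θ (R θ) (e, α, β, c)) θ)
    (hR' : ∀ θ, HasDerivAt R' (clampedField θ (R' θ) (e, α, β, c)) θ)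
    (hb : ∀ θ, R θ ∈ Ioo (d / 4) (4 * d)) (hb' : ∀ θ, R' θ ∈ Ioo (d / 4) (4 * d))
    {θ₀ : ℝ} {n : ℕ} (hn : 0 < n) (hp : R (θ₀ + n * (2 * π)) = R θ₀)
    (hp' : R' (θ₀ + n * (2 * π)) = R' θ₀) : R = R' := by
  wlog hle : R θ₀ ≤ R' θ₀ generalizing R R' with H
  · exact (H hR' hR hb' hb hp' hp (le_of_not_ge hle)).symm
  rcases hle.eq_or_lt with heq | hlt
  · exact clampedField_unique hR hR' heq
  exfalso
  have hx : θ₀ < θ₀ + n * (2 * π) := by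
    have : (0 : ℝ) < n := by exact_mod_cast hn
    have := mul_pos this two_pi_pos
    linarith
  have h1 := h.strictAntiOn_lyap_sub hη (x := θ₀) (y := θ₀ + n * (2 * π)) (fun θ _ => hR θ)
    (fun θ _ => hR' θ)
    (fun θ _ => ⟨(hb θ).1.le, lt_of_clampedField hR hR' hlt θ, (hb' θ).2.le⟩)
  have h2 := h1 ⟨le_rfl, hx.le⟩ ⟨hx.le, le_rfl⟩ hx
  simp only [lyap_add_nat_mul_two_pi, hp, hp'] at h2
  exact lt_irrefl _ h2

end

/-! ### Polar and Cartesian coordinates -/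

/-- Change of the independent variable: a function with derivative bounded below by a positive
constant has a global differentiable inverse. -/
lemma exists_hasDerivAt_inverse {φ v : ℝ → ℝ} {m : ℝ} (hm : 0 < m)
    (hφ : ∀ t, HasDerivAt φ (v t) t) (hv : ∀ t, m ≤ v t) :
    StrictMono φ ∧ ∃ ψ : ℝ → ℝ, (∀ x, φ (ψ x) = x) ∧ (∀ t, ψ (φ t) = t) ∧
      ∀ x, HasDerivAt ψ (v (ψ x))⁻¹ x := by
  have hmono : StrictMono φ := strictMono_of_deriv_pos fun t => by
    rw [(hφ t).deriv]; exact hm.trans_le (hv t)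
  have hcont : Continuous φ := continuous_iff_continuousAt.2 fun t => (hφ t).continuousAt
  have hlin : Monotone fun t => φ t - m * t :=
    monotone_of_hasDerivAt_nonneg
      (fun t => (hφ t).sub ((hasDerivAt_id t).const_mul m)) fun t => by
        have := hv t
        simp only [Pi.zero_apply]
        linarith
  have hsurj : Function.Surjective φ := by
    refine hcont.surjective ?_ ?_
    · refine tendsto_atTop_mono' _ ?_
        (tendsto_atTop_add_const_left _ (φ 0) (tendsto_id.const_mul_atTop hm))
      filter_upwards [eventually_ge_atTop 0] with t ht
      have := hlin ht
      simp only [mul_zero, id] at this ⊢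
      linarith
    · refine tendsto_atBot_mono' _ ?_
        (tendsto_atBot_add_const_left _ (φ 0) (tendsto_id.const_mul_atBot hm))
      filter_upwards [eventually_le_atBot 0] with t ht
      have := hlin ht
      simp only [mul_zero, id] at this ⊢
      linarith
  let o := hmono.orderIsoOfSurjective φ hsurj
  have h1 : ∀ x, φ (o.symm x) = x := fun x => o.apply_symm_apply x
  refine ⟨hmono, o.symm, h1, fun t => o.symm_apply_apply t, fun x => ?_⟩
  exact HasDerivAt.of_local_left_inverse o.symm.continuous.continuousAt (hφ _)
    (hm.trans_le (hv _)).ne' (Eventually.of_forall h1)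

lemma kukles_toFun (a b c : ℝ) (p : Fin 2 → ℝ) :
    (kukles (a, b, c)).toFun p = ![-p 1, p 0 + p 1 * (p 0 ^ 2 + p 1 ^ 2 - 1) *
      (a * p 0 + b * p 1 + c)] := by
  ext i
  fin_cases i <;> simp [PlanarField.toFun, kukles]

/-- The point of the plane with rescaled polar coordinates `(R, θ)`, that is, with radius `R / L`. -/
noncomputable def polarPoint (L R θ : ℝ) : Fin 2 → ℝ := ![R / L * cos θ, R / L * sin θ]

section
variable {a b c L : ℝ}

/-- Polar representation of a planar curve: if `r` and `ϑ` satisfy the equations of the modulus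
and the argument of `(x, y)` and have the right initial values, they are the modulus and an
argument. -/
lemma eq_polar {x y r ϑ ρ ω : ℝ → ℝ} (hx : ∀ t, HasDerivAt x (ρ t * x t - ω t * y t) t)
    (hy : ∀ t, HasDerivAt y (ρ t * y t + ω t * x t) t) (hr : ∀ t, HasDerivAt r (ρ t * r t) t)
    (hϑ : ∀ t, HasDerivAt ϑ (ω t) t) (hr0 : ∀ t, r t ≠ 0) (hx0 : x 0 = r 0 * cos (ϑ 0))
    (hy0 : y 0 = r 0 * sin (ϑ 0)) (t : ℝ) : x t = r t * cos (ϑ t) ∧ y t = r t * sin (ϑ t) := by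
  -- the relative squared distance between the curve and its polar form is constant
  have hD : ∀ t, HasDerivAt (fun t => ((r t * cos (ϑ t) - x t) ^ 2
      + (r t * sin (ϑ t) - y t) ^ 2) / r t ^ 2) 0 t := fun t => by
    have h1 := ((((hr t).mul (hϑ t).cos).sub (hx t)).pow 2).add
      ((((hr t).mul (hϑ t).sin).sub (hy t)).pow 2)
    refine (h1.div ((hr t).pow 2) (pow_ne_zero 2 (hr0 t))).congr_deriv ?_
    simp only [Pi.mul_apply, Pi.sub_apply, Pi.pow_apply, Pi.add_apply, Nat.cast_ofNat,
      Nat.add_one_sub_one, pow_one]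
    refine div_eq_zero_iff.2 (Or.inl ?_)
    ring
  have h1 := is_const_of_deriv_eq_zero (fun t => (hD t).differentiableAt)
    (fun t => (hD t).deriv) t 0
  simp only [← hx0, ← hy0, sub_self] at h1
  have h2 := (div_eq_iff (pow_ne_zero 2 (hr0 t))).1 h1
  norm_num at h2
  have h3 := (add_eq_zero_iff_of_nonneg (sq_nonneg _) (sq_nonneg _)).1 h2
  exact ⟨(sub_eq_zero.1 (pow_eq_zero_iff two_ne_zero |>.1 h3.1)).symm,
    (sub_eq_zero.1 (pow_eq_zero_iff two_ne_zero |>.1 h3.2)).symm⟩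

lemma damping_polar (R θ : ℝ) :
    damping (1 / L ^ 2) (a / L) (b / L) c (cos θ) (sin θ) R =
      ((R / L * cos θ) ^ 2 + (R / L * sin θ) ^ 2 - 1) *
        (a * (R / L * cos θ) + b * (R / L * sin θ) + c) := by
  have h : (R / L * cos θ) ^ 2 + (R / L * sin θ) ^ 2 = 1 / L ^ 2 * R ^ 2 := by
    have := sin_sq_add_cos_sq θ
    calc _ = R ^ 2 / L ^ 2 * (sin θ ^ 2 + cos θ ^ 2) := by ring
      _ = _ := by rw [this]; ring
  rw [h, damping]
  ring

lemma scaled_params (hL : 1 ≤ L) (ha : |a| ≤ L) (hb : |b| ≤ L) :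
    1 / L ^ 2 ∈ Icc (0 : ℝ) 1 ∧ |a / L| ≤ 1 ∧ |b / L| ≤ 1 := by
  have hL0 : 0 < L := by linarith
  refine ⟨⟨by positivity, ?_⟩, ?_, ?_⟩
  · rw [div_le_one (by positivity)]; nlinarith
  · rw [abs_div, abs_of_pos hL0, div_le_one hL0]; exact ha
  · rw [abs_div, abs_of_pos hL0, div_le_one hL0]; exact hb

/-- A `2π`-periodic solution of the polar equation traces a periodic orbit. The time is recovered
as the integral of the inverse angular speed. -/
theorem isPeriodicOrbit_of_polar (hL : 1 ≤ L) (ha : |a| ≤ L) (hb : |b| ≤ L) (hc : |c| ≤ 1 / 200)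
    {R : ℝ → ℝ} (hR : ∀ θ, HasDerivAt R
      (R θ * radialRate (1 / L ^ 2) (a / L) (b / L) c (cos θ) (sin θ) (R θ)) θ)
    (hper : ∀ θ, R (θ + 2 * π) = R θ) (hb0 : ∀ θ, R θ ∈ Ioc 0 (1 / 200)) :
    (kukles (a, b, c)).IsPeriodicOrbit (range fun θ => polarPoint L (R θ) θ) := by
  have hL0 : 0 < L := by linarith
  obtain ⟨he, hα, hβ⟩ := scaled_params hL ha hb
  have hRc : Continuous R := continuous_iff_continuousAt.2 fun t => (hR t).continuousAt
  let Q : ℝ → ℝ := fun θ => damping (1 / L ^ 2) (a / L) (b / L) c (cos θ) (sin θ) (R θ)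
  let w : ℝ → ℝ := fun θ => 1 + sin θ * cos θ * Q θ
  have hR200 : ∀ θ, |R θ| ≤ 1 / 200 := fun θ => by
    rw [abs_of_pos (hb0 θ).1]; exact (hb0 θ).2
  have hw1 : ∀ θ, 197 / 200 ≤ w θ := fun θ =>
    angular_speed_ge he hα hβ (abs_cos_le_one θ) (abs_sin_le_one θ) hc (hR200 θ)
  have hw2 : ∀ θ, w θ ≤ 2 := fun θ => by
    have h1 := abs_damping_le_of_small he hα hβ (abs_cos_le_one θ) (abs_sin_le_one θ) hc (hR200 θ)
    have h2 := one_sub_le_one_add (q := -Q θ) (abs_cos_le_one θ) (abs_sin_le_one θ)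
    rw [abs_neg] at h2
    simp only [w]
    have : |Q θ| ≤ 3 / 200 := h1
    linarith
  have hwpos : ∀ θ, 0 < w θ := fun θ => lt_of_lt_of_le (by norm_num) (hw1 θ)
  have hwc : Continuous w := by
    simp only [w, Q, damping]
    fun_prop
  have hwinv : Continuous fun θ => (w θ)⁻¹ := hwc.inv₀ fun θ => (hwpos θ).ne'
  have hwper : Function.Periodic (fun θ => (w θ)⁻¹) (2 * π) := fun θ => by
    simp only [w, Q, cos_add_two_pi, sin_add_two_pi, hper]
  -- the time at which the orbit reaches the angle `θ`
  let φ : ℝ → ℝ := fun θ => ∫ u in (0 : ℝ)..θ, (w u)⁻¹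
  have hφ : ∀ θ, HasDerivAt φ (w θ)⁻¹ θ := fun θ =>
    intervalIntegral.integral_hasDerivAt_right (hwinv.intervalIntegrable _ _)
      hwinv.stronglyMeasurable.stronglyMeasurableAtFilter hwinv.continuousAt
  have hφper : ∀ θ, φ (θ + 2 * π) = φ θ + φ (2 * π) := fun θ => by
    have h1 := intervalIntegral.integral_add_adjacent_intervals
      (hwinv.intervalIntegrable (μ := MeasureTheory.volume) 0 θ)
      (hwinv.intervalIntegrable θ (θ + 2 * π))
    have h2 := hwper.intervalIntegral_add_eq θ 0
    rw [zero_add] at h2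
    simp only [φ]
    rw [← h1, h2]
  obtain ⟨hφmono, ψ, hφψ, hψφ, hψ⟩ := exists_hasDerivAt_inverse (m := 1 / 2) (by norm_num) hφ
    fun θ => by
      rw [← one_div]; exact one_div_le_one_div_of_le (hwpos θ) (hw2 θ)
  refine ⟨fun t => polarPoint L (R (ψ t)) (ψ t), φ (2 * π), ?_, fun t => ?_, fun t => ?_,
    ⟨φ 0, φ π, ?_⟩, ?_⟩
  · have := hφmono two_pi_pos
    simpa [φ] using this
  · have hψt : HasDerivAt ψ (w (ψ t)) t := by simpa using hψ t
    have hRt := (hR (ψ t)).comp t hψt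
    have hrad : R (ψ t) * radialRate (1 / L ^ 2) (a / L) (b / L) c (cos (ψ t)) (sin (ψ t))
        (R (ψ t)) * w (ψ t) = R (ψ t) * (sin (ψ t) ^ 2 * Q (ψ t)) := by
      rw [radialRate, mul_assoc, div_mul_cancel₀ _ (hwpos (ψ t)).ne']
    rw [hrad] at hRt
    have hQ := damping_polar (a := a) (b := b) (c := c) (L := L) (R (ψ t)) (ψ t)
    change Q (ψ t) = _ at hQ
    have h1 := sin_sq_add_cos_sq (ψ t)
    rw [hasDerivAt_pi, kukles_toFun]
    have hx := (hRt.div_const L).mul hψt.cos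
    have hy := (hRt.div_const L).mul hψt.sin
    intro i
    fin_cases i
    · refine hx.congr_deriv ?_
      simp only [w, polarPoint]
      simp
      ring
    · refine hy.congr_deriv ?_
      simp only [w, polarPoint, Function.comp]
      simp only [Fin.mk_one, Matrix.cons_val_one, Matrix.cons_val_zero, Matrix.cons_val_fin_one]
      rw [mul_assoc (R (ψ t) / L * sin (ψ t)), ← hQ]
      linear_combination (R (ψ t) / L * sin (ψ t) * Q (ψ t)) * h1
  · have : ψ (t + φ (2 * π)) = ψ t + 2 * π := by
      apply hφmono.injective
      rw [hφψ, hφper, hφψ]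
    simp only [this, hper, polarPoint, cos_add_two_pi, sin_add_two_pi]
  · intro h
    have h0 := congrFun h 0
    simp only [hψφ, polarPoint, cos_zero, cos_pi, Matrix.cons_val_zero] at h0
    have h1 := div_pos (hb0 0).1 hL0
    have h2 := div_pos (hb0 π).1 hL0
    linarith
  · ext p
    constructor
    · rintro ⟨θ, rfl⟩
      exact ⟨φ θ, by simp only [hψφ]⟩
    · rintro ⟨t, rfl⟩
      exact ⟨ψ t, rfl⟩

/-- A periodic orbit close to the origin is traced by a solution `R` of the polar equation that
takes up its value at some angle again after `n` turns; `ϑ` is the angle as a function of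
time. -/
theorem exists_polar_of_periodic (hL : 1 ≤ L) (ha : |a| ≤ L) (hb : |b| ≤ L) (hc : |c| ≤ 1 / 200)
    {γ : ℝ → Fin 2 → ℝ} {T : ℝ} (hT : 0 < T)
    (hγ : ∀ t, HasDerivAt γ ((kukles (a, b, c)).toFun (γ t)) t) (hper : ∀ t, γ (t + T) = γ t)
    (hpos : ∀ t, 0 < γ t 0 ^ 2 + γ t 1 ^ 2)
    (hsmall : ∀ t, L * √(γ t 0 ^ 2 + γ t 1 ^ 2) ≤ 1 / 200) :
    ∃ (R ϑ : ℝ → ℝ) (n : ℕ) (θ₀ : ℝ), 0 < n ∧ Function.Surjective ϑ ∧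
      (∀ θ, HasDerivAt R
        (R θ * radialRate (1 / L ^ 2) (a / L) (b / L) c (cos θ) (sin θ) (R θ)) θ) ∧
      (∀ t, R (ϑ t) = L * √(γ t 0 ^ 2 + γ t 1 ^ 2)) ∧
      (∀ t, γ t = polarPoint L (R (ϑ t)) (ϑ t)) ∧ R (θ₀ + n * (2 * π)) = R θ₀ := by
  have hL0 : 0 < L := by linarith
  obtain ⟨he, hα, hβ⟩ := scaled_params hL ha hb
  let x : ℝ → ℝ := fun t => γ t 0
  let y : ℝ → ℝ := fun t => γ t 1
  let r : ℝ → ℝ := fun t => √(x t ^ 2 + y t ^ 2)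
  let Q : ℝ → ℝ := fun t => (x t ^ 2 + y t ^ 2 - 1) * (a * x t + b * y t + c)
  let w : ℝ → ℝ := fun t => 1 + x t * y t * Q t / (x t ^ 2 + y t ^ 2)
  have hpos' : ∀ t, 0 < x t ^ 2 + y t ^ 2 := hpos
  have hx : ∀ t, HasDerivAt x (-y t) t := fun t => by
    have := (hasDerivAt_pi.1 (hγ t)) 0
    rw [kukles_toFun] at this
    exact this
  have hy : ∀ t, HasDerivAt y (x t + y t * Q t) t := fun t => by
    have := (hasDerivAt_pi.1 (hγ t)) 1
    rw [kukles_toFun] at this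
    refine this.congr_deriv ?_
    simp only [Matrix.cons_val_one, Matrix.cons_val_fin_one, x, y, Q]
    ring
  have hrpos : ∀ t, 0 < r t := fun t => sqrt_pos.2 (hpos t)
  have hr2 : ∀ t, r t ^ 2 = x t ^ 2 + y t ^ 2 := fun t => sq_sqrt (hpos t).le
  have hN : ∀ t, HasDerivAt (fun t => x t ^ 2 + y t ^ 2) (2 * (y t ^ 2 * Q t)) t := fun t => by
    refine (((hx t).pow 2).add ((hy t).pow 2)).congr_deriv ?_
    push_cast
    ring
  have hr : ∀ t, HasDerivAt r (y t ^ 2 * Q t / r t) t := fun t => by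
    refine ((hN t).sqrt (hpos' t).ne').congr_deriv ?_
    exact mul_div_mul_left _ _ two_ne_zero
  have hxc : Continuous x := continuous_iff_continuousAt.2 fun t => (hx t).continuousAt
  have hyc : Continuous y := continuous_iff_continuousAt.2 fun t => (hy t).continuousAt
  have hwc : Continuous w := by
    have : Continuous Q := by simp only [Q]; fun_prop
    exact continuous_const.add (((hxc.mul hyc).mul this).div
      ((hxc.pow 2).add (hyc.pow 2)) fun t => (hpos' t).ne')
  -- the angle, started at the argument of the initial point
  obtain ⟨θ₀, hθx, hθy⟩ : ∃ θ₀, x 0 = r 0 * cos θ₀ ∧ y 0 = r 0 * sin θ₀ := by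
    let z : ℂ := ⟨x 0, y 0⟩
    have hz : ‖z‖ = r 0 := by
      rw [Complex.norm_def, Complex.normSq_apply]
      simp only [z, r]
      congr 1
      ring
    refine ⟨z.arg, ?_, ?_⟩
    · rw [← hz, Complex.norm_mul_cos_arg]
    · rw [← hz, Complex.norm_mul_sin_arg]
  let ϑ : ℝ → ℝ := fun t => θ₀ + ∫ u in (0 : ℝ)..t, w u
  have hϑ : ∀ t, HasDerivAt ϑ (w t) t := fun t =>
    (intervalIntegral.integral_hasDerivAt_right (hwc.intervalIntegrable _ _)
      hwc.stronglyMeasurable.stronglyMeasurableAtFilter hwc.continuousAt).const_add _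
  have hϑ0 : ϑ 0 = θ₀ := by simp [ϑ]
  let ρ : ℝ → ℝ := fun t => y t ^ 2 * Q t / (x t ^ 2 + y t ^ 2)
  have hpolar : ∀ t, x t = r t * cos (ϑ t) ∧ y t = r t * sin (ϑ t) := by
    refine eq_polar (ρ := ρ) (ω := w) (fun t => (hx t).congr_deriv ?_)
      (fun t => (hy t).congr_deriv ?_) (fun t => (hr t).congr_deriv ?_) hϑ
      (fun t => (hrpos t).ne') (by rw [hϑ0, hθx]) (by rw [hϑ0, hθy])
    · have := (hpos' t).ne'
      simp only [ρ, w]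
      field_simp
      ring
    · have := (hpos' t).ne'
      simp only [ρ, w]
      field_simp
      ring
    · have := (hrpos t).ne'
      simp only [ρ]
      rw [← hr2]
      field_simp
  have hLr : ∀ t, L * r t / L = r t := fun t => mul_div_cancel_left₀ _ hL0.ne'
  let D : ℝ → ℝ := fun t =>
    damping (1 / L ^ 2) (a / L) (b / L) c (cos (ϑ t)) (sin (ϑ t)) (L * r t)
  have hDQ : ∀ t, D t = Q t := fun t => by
    simp only [D, Q]
    rw [damping_polar, hLr, ← (hpolar t).1, ← (hpolar t).2]
  have hwD : ∀ t, w t = 1 + sin (ϑ t) * cos (ϑ t) * D t := fun t => by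
    have h1 := (hrpos t).ne'
    simp only [w]
    rw [hDQ, ← hr2, (hpolar t).1, (hpolar t).2]
    field_simp
  have hw1 : ∀ t, 197 / 200 ≤ w t := fun t => by
    rw [hwD]
    exact angular_speed_ge he hα hβ (abs_cos_le_one _) (abs_sin_le_one _) hc
      (by rw [abs_of_pos (mul_pos hL0 (hrpos t))]; exact hsmall t)
  obtain ⟨hmono, ψ, hϑψ, hψϑ, hψ⟩ := exists_hasDerivAt_inverse (by norm_num) hϑ hw1
  obtain ⟨n, hn⟩ : ∃ n : ℤ, n * (2 * π) = ϑ T - ϑ 0 := by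
    have h1 : γ T = γ 0 := by simpa using hper 0
    have hx1 : x T = x 0 := congrFun h1 0
    have hy1 : y T = y 0 := congrFun h1 1
    have hr1 : r T = r 0 := by simp only [r, hx1, hy1]
    have h2 : cos (ϑ T) = cos (ϑ 0) := by
      have := (hpolar T).1
      rw [hx1, (hpolar 0).1, hr1] at this
      exact (mul_left_cancel₀ (hrpos 0).ne' this).symm
    have h3 : sin (ϑ T) = sin (ϑ 0) := by
      have := (hpolar T).2
      rw [hy1, (hpolar 0).2, hr1] at this
      exact (mul_left_cancel₀ (hrpos 0).ne' this).symm
    refine (cos_eq_one_iff _).1 ?_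
    rw [cos_sub, h2, h3]
    linarith [sin_sq_add_cos_sq (ϑ 0)]
  have hnpos : 0 < n := by
    have h1 := hmono hT
    by_contra h2
    have h3 : (n : ℝ) ≤ 0 := by exact_mod_cast not_lt.1 h2
    have h4 := mul_nonpos_of_nonpos_of_nonneg h3 two_pi_pos.le
    linarith
  have hnat : ((n.toNat : ℕ) : ℝ) = n := by
    exact_mod_cast Int.toNat_of_nonneg hnpos.le
  refine ⟨fun θ => L * r (ψ θ), ϑ, n.toNat, ϑ 0, by omega, fun θ => ⟨ψ θ, hϑψ θ⟩,
    fun θ => ?_, fun t => by simp only [hψϑ, r, x, y], fun t => ?_, ?_⟩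
  · refine (((hr (ψ θ)).comp θ (hψ θ)).const_mul L).congr_deriv ?_
    have h1 := (hrpos (ψ θ)).ne'
    have h2 : w (ψ θ) ≠ 0 := (lt_of_lt_of_le (by norm_num) (hw1 (ψ θ))).ne'
    have h3 : radialRate (1 / L ^ 2) (a / L) (b / L) c (cos θ) (sin θ) (L * r (ψ θ)) =
        sin θ ^ 2 * Q (ψ θ) / w (ψ θ) := by
      rw [radialRate, hwD, ← hDQ]
      simp only [D, hϑψ]
    rw [h3, (hpolar (ψ θ)).2, hϑψ]
    field_simp
  · simp only [polarPoint, hψϑ, hLr]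
    ext i
    fin_cases i
    · exact (hpolar t).1
    · exact (hpolar t).2
  · have h1 : γ T = γ 0 := by simpa using hper 0
    simp only [hnat, hn]
    rw [add_sub_cancel, hψϑ, hψϑ]
    simp only [r, x, y, h1]

end

/-! ### The family of limit cycles -/

/-- The factor `L` by which the plane is rescaled. -/
noncomputable def scale (μ : ℝ × ℝ × ℝ) : ℝ := 1 + |μ.1| + |μ.2.1|

/-- The parameters `(e, α, β, c)` of the rescaled polar equation. -/
noncomputable def scaled (μ : ℝ × ℝ × ℝ) : ℝ × ℝ × ℝ × ℝ :=
  (1 / scale μ ^ 2, μ.1 / scale μ, μ.2.1 / scale μ, μ.2.2)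

/-- The size `|α β|` of the (rescaled) focal value, up to the factor `8`. -/
noncomputable def strength (μ : ℝ × ℝ × ℝ) : ℝ := |μ.1 / scale μ * (μ.2.1 / scale μ)|

/-- The rescaled radius `d` defined by `4 |c| = |α β| d²`. The junk value for `α β = 0` is not
used. -/
noncomputable def size (μ : ℝ × ℝ × ℝ) : ℝ := 2 * √(|μ.2.2| / strength μ)

/-- The parameters for which a small limit cycle is found. The second condition says that
`size μ < η * strength μ`, without division. -/
def region (η : ℝ) : Set (ℝ × ℝ × ℝ) :=
  {μ | μ.1 * μ.2.1 * μ.2.2 < 0 ∧ 4 * |μ.2.2| < η ^ 2 * strength μ ^ 3}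

open Classical in
/-- The fixed point of the return map between `size μ / 2` and `2 * size μ`, with value `0` if
there is none. -/
noncomputable def radius (μ : ℝ × ℝ × ℝ) : ℝ :=
  if h : ∃ r ∈ Ioo (size μ / 2) (2 * size μ), returnMap (r, scaled μ) = r then h.choose else 0

/-- The limit cycle, traced by the solution of the polar equation starting at the fixed point. -/
noncomputable def cycle (μ : ℝ × ℝ × ℝ) : Set (Fin 2 → ℝ) :=
  range fun θ => polarPoint (scale μ) (flow (radius μ, scaled μ) θ) θ

lemma one_le_scale (μ : ℝ × ℝ × ℝ) : 1 ≤ scale μ := by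
  unfold scale; linarith [abs_nonneg μ.1, abs_nonneg μ.2.1]

lemma scale_pos (μ : ℝ × ℝ × ℝ) : 0 < scale μ := zero_lt_one.trans_le (one_le_scale μ)

lemma abs_fst_le_scale (μ : ℝ × ℝ × ℝ) : |μ.1| ≤ scale μ := by
  unfold scale; linarith [abs_nonneg μ.2.1]

lemma abs_snd_le_scale (μ : ℝ × ℝ × ℝ) : |μ.2.1| ≤ scale μ := by
  unfold scale; linarith [abs_nonneg μ.1]

lemma continuous_scale : Continuous scale := by unfold scale; fun_prop

lemma continuous_scaled : Continuous scaled := by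
  have := continuous_scale
  unfold scaled
  refine (continuous_const.div (this.pow 2) fun μ => pow_ne_zero 2 (scale_pos μ).ne').prodMk
    ((continuous_fst.div this fun μ => (scale_pos μ).ne').prodMk
      (((continuous_fst.comp continuous_snd).div this fun μ => (scale_pos μ).ne').prodMk
        (continuous_snd.comp continuous_snd)))

lemma continuous_scaled_mul : Continuous fun μ => (scaled μ).2.1 * (scaled μ).2.2.1 :=
  (continuous_fst.comp (continuous_snd.comp continuous_scaled)).mul
    (continuous_fst.comp (continuous_snd.comp (continuous_snd.comp continuous_scaled)))

lemma continuous_strength : Continuous strength := continuous_scaled_mul.abs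

lemma strength_pos {μ : ℝ × ℝ × ℝ} (h : μ.1 * μ.2.1 ≠ 0) : 0 < strength μ := by
  have h1 := (scale_pos μ).ne'
  exact abs_pos.2 (mul_ne_zero (div_ne_zero (left_ne_zero_of_mul h) h1)
    (div_ne_zero (right_ne_zero_of_mul h) h1))

lemma continuousAt_size {μ : ℝ × ℝ × ℝ} (h : μ.1 * μ.2.1 ≠ 0) : ContinuousAt size μ := by
  have h1 : ContinuousAt (fun μ : ℝ × ℝ × ℝ => |μ.2.2| / strength μ) μ :=
    ContinuousAt.div (by fun_prop) continuous_strength.continuousAt (strength_pos h).ne'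
  exact (h1.sqrt).const_mul 2

lemma isOpen_region (η : ℝ) : IsOpen (region η) := by
  have h := continuous_strength
  have h1 : IsOpen {μ : ℝ × ℝ × ℝ | μ.1 * μ.2.1 * μ.2.2 < 0} :=
    isOpen_lt (by fun_prop) continuous_const
  have h2 : IsOpen {μ : ℝ × ℝ × ℝ | 4 * |μ.2.2| < η ^ 2 * strength μ ^ 3} :=
    isOpen_lt (by fun_prop) ((h.pow 3).const_mul _)
  exact h1.inter h2

variable {η : ℝ} {μ : ℝ × ℝ × ℝ}

lemma ne_zero_of_mem_region (hμ : μ ∈ region η) : μ.1 * μ.2.1 ≠ 0 := fun h0 => by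
  have := hμ.1
  rw [h0, zero_mul] at this
  exact lt_irrefl _ this

lemma isSmall_of_mem (hη : IsThreshold η) (hμ : μ ∈ region η) :
    IsSmall η (scaled μ).1 (scaled μ).2.1 (scaled μ).2.2.1 (scaled μ).2.2.2 (size μ) := by
  obtain ⟨he, hα, hβ⟩ := scaled_params (one_le_scale μ) (abs_fst_le_scale μ) (abs_snd_le_scale μ)
  have hm := strength_pos (ne_zero_of_mem_region hμ)
  have hc : 0 < |μ.2.2| := abs_pos.2 fun h0 => by
    have := hμ.1
    rw [h0, mul_zero] at this
    exact lt_irrefl _ this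
  have hsq : size μ ^ 2 = 4 * (|μ.2.2| / strength μ) := by
    rw [size, mul_pow, sq_sqrt (by positivity)]; norm_num
  refine ⟨he, hα, hβ, ?_, ?_, ?_, ?_⟩
  · exact mul_pos two_pos (sqrt_pos.2 (by positivity))
  · refine lt_of_pow_lt_pow_left₀ 2 (mul_nonneg hη.pos.le (abs_nonneg _)) ?_
    change size μ ^ 2 < (η * strength μ) ^ 2
    rw [hsq, ← mul_div_assoc, div_lt_iff₀ hm]
    calc 4 * |μ.2.2| < η ^ 2 * strength μ ^ 3 := hμ.2
      _ = (η * strength μ) ^ 2 * strength μ := by ring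
  · change 4 * |μ.2.2| = strength μ * size μ ^ 2
    rw [hsq]; field_simp
  · have h1 := scale_pos μ
    have h2 : μ.1 / scale μ * (μ.2.1 / scale μ) * μ.2.2 = μ.1 * μ.2.1 * μ.2.2 / scale μ ^ 2 := by
      field_simp
    change μ.1 / scale μ * (μ.2.1 / scale μ) * μ.2.2 < 0
    rw [h2]
    exact div_neg_of_neg_of_pos hμ.1 (by positivity)

lemma radius_spec (hη : IsThreshold η) (hμ : μ ∈ region η) :
    radius μ ∈ Ioo (size μ / 2) (2 * size μ) ∧ returnMap (radius μ, scaled μ) = radius μ := by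
  obtain ⟨r, hr, hfix, -⟩ := (isSmall_of_mem hη hμ).exists_fixed hη
  have h : ∃ r ∈ Ioo (size μ / 2) (2 * size μ), returnMap (r, scaled μ) = r := ⟨r, hr, hfix⟩
  rw [radius, dif_pos h]
  exact h.choose_spec

lemma returnMap_sign (hη : IsThreshold η) (hμ : μ ∈ region η) :
    (∀ r, size μ / 2 ≤ r → r < radius μ →
      0 < (scaled μ).2.1 * (scaled μ).2.2.1 * (returnMap (r, scaled μ) - r)) ∧
    (∀ r, radius μ < r → r ≤ 2 * size μ →
      (scaled μ).2.1 * (scaled μ).2.2.1 * (returnMap (r, scaled μ) - r) < 0) := by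
  obtain ⟨r, hr, -, h1, h2⟩ := (isSmall_of_mem hη hμ).exists_fixed hη
  obtain ⟨h3, h4⟩ := radius_spec hη hμ
  suffices radius μ = r by rw [this]; exact ⟨h1, h2⟩
  rcases lt_trichotomy (radius μ) r with h | h | h
  · have := h1 _ h3.1.le h
    rw [show returnMap (radius μ, (scaled μ).1, (scaled μ).2.1, (scaled μ).2.2.1,
      (scaled μ).2.2.2) = radius μ from h4, sub_self, mul_zero] at this
    exact absurd this (lt_irrefl _)
  · exact h
  · have := h2 _ h h3.2.le
    rw [show returnMap (radius μ, (scaled μ).1, (scaled μ).2.1, (scaled μ).2.2.1,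
      (scaled μ).2.2.2) = radius μ from h4, sub_self, mul_zero] at this
    exact absurd this (lt_irrefl _)

/-- Radii `r` on either side of the fixed point are recognized by the sign of the displacement at
`r`, which persists under small changes of the parameters. -/
lemma continuousOn_radius (hη : IsThreshold η) : ContinuousOn radius (region η) := by
  intro μ hμ
  refine ContinuousAt.continuousWithinAt ?_
  have hsize := continuousAt_size (ne_zero_of_mem_region hμ)
  have hreg : ∀ᶠ ν in 𝓝 μ, ν ∈ region η := (isOpen_region η).mem_nhds hμ
  obtain ⟨⟨h1, h2⟩, -⟩ := radius_spec hη hμ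
  have hsign := returnMap_sign hη hμ
  have hcont : ∀ r, Continuous fun ν =>
      (scaled ν).2.1 * (scaled ν).2.2.1 * (returnMap (r, scaled ν) - r) := fun r =>
    continuous_scaled_mul.mul
      ((continuous_returnMap.comp (continuous_const.prodMk continuous_scaled)).sub continuous_const)
  refine tendsto_order.2 ⟨fun l hl => ?_, fun l hl => ?_⟩
  · obtain ⟨r, hr1, hr2⟩ := exists_between (max_lt hl h1)
    have hr3 : size μ / 2 < r := (le_max_right _ _).trans_lt hr1
    have e1 : ∀ᶠ ν in 𝓝 μ, size ν / 2 < r := (hsize.div_const 2).eventually_lt_const hr3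
    have e2 := (hcont r).continuousAt.eventually_const_lt (hsign.1 r hr3.le hr2)
    have e3 : ∀ᶠ ν in 𝓝 μ, r < 2 * size ν :=
      (hsize.const_mul 2).eventually_const_lt (hr2.trans h2)
    filter_upwards [hreg, e1, e2, e3] with ν hν n1 n2 n3
    refine ((le_max_left _ _).trans_lt hr1).trans ?_
    by_contra hle
    rcases (not_lt.1 hle).eq_or_lt with h | h
    · rw [← h, (radius_spec hη hν).2, sub_self, mul_zero] at n2
      exact lt_irrefl _ n2
    · exact lt_asymm n2 ((returnMap_sign hη hν).2 r h n3.le)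
  · obtain ⟨r, hr1, hr2⟩ := exists_between (lt_min hl h2)
    have hr3 : r < 2 * size μ := hr2.trans_le (min_le_right _ _)
    have e1 : ∀ᶠ ν in 𝓝 μ, size ν / 2 < r := (hsize.div_const 2).eventually_lt_const (h1.trans hr1)
    have e2 := (hcont r).continuousAt.eventually_lt_const (hsign.2 r hr1 hr3.le)
    filter_upwards [hreg, e1, e2] with ν hν n1 n2
    refine lt_trans ?_ (hr2.trans_le (min_le_left _ _))
    by_contra hle
    rcases (not_lt.1 hle).eq_or_lt with h | h
    · rw [h, (radius_spec hη hν).2, sub_self, mul_zero] at n2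
      exact lt_irrefl _ n2
    · exact lt_asymm n2 ((returnMap_sign hη hν).1 r n1.le h)

lemma flow_mem (hη : IsThreshold η) (hμ : μ ∈ region η) (θ : ℝ) :
    flow (radius μ, scaled μ) θ ∈ Ioo (size μ / 4) (4 * size μ) :=
  (isSmall_of_mem hη hμ).periodic_flow_bounds (radius_spec hη hμ).1 (radius_spec hη hμ).2 θ

lemma mul_sqrt_polarPoint {L R θ : ℝ} (hL : 0 < L) (hR : 0 ≤ R) :
    L * √(polarPoint L R θ 0 ^ 2 + polarPoint L R θ 1 ^ 2) = R := by
  have h : polarPoint L R θ 0 ^ 2 + polarPoint L R θ 1 ^ 2 = (R / L) ^ 2 := by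
    have := sin_sq_add_cos_sq θ
    simp only [polarPoint, Matrix.cons_val_zero, Matrix.cons_val_one, Matrix.cons_val_fin_one]
    linear_combination (R / L) ^ 2 * this
  rw [h, sqrt_sq (by positivity)]
  field_simp

/-- The isolating neighborhood is the annulus `d / 4 < L |p| < 4 d`. -/
theorem isLimitCycle_cycle (hη : IsThreshold η) (hμ : μ ∈ region η) :
    (kukles μ).IsLimitCycle (cycle μ) := by
  have hs := isSmall_of_mem hη hμ
  have hd := hs.d_pos
  have hd1 := hs.d_lt_of_le hη.le
  have hc : |μ.2.2| ≤ 1 / 200 := by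
    have : |μ.2.2| ≤ size μ / 4 := hs.abs_c_le (hη.le.trans (by norm_num))
    linarith
  obtain ⟨-, hfix⟩ := radius_spec hη hμ
  have hb := flow_mem hη hμ
  have hfield : ∀ R θ : ℝ, R ∈ Ioo (size μ / 4) (4 * size μ) → clampedField θ R (scaled μ) =
      R * radialRate (1 / scale μ ^ 2) (μ.1 / scale μ) (μ.2.1 / scale μ) μ.2.2 (cos θ) (sin θ) R :=
    fun R θ hR => hs.clampedField_eq hη (by linarith [hR.1]) hR.2.le θ
  have hper := hasDerivAt_flow (radius μ, scaled μ)
  refine ⟨isPeriodicOrbit_of_polar (one_le_scale μ) (abs_fst_le_scale μ) (abs_snd_le_scale μ) hc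
      (fun θ => (hfield _ θ (hb θ)) ▸ hper θ) (flow_add_two_pi hfix)
      (fun θ => ⟨by linarith [(hb θ).1], by linarith [(hb θ).2]⟩),
    (fun p : Fin 2 → ℝ => scale μ * √(p 0 ^ 2 + p 1 ^ 2)) ⁻¹' Ioo (size μ / 4) (4 * size μ),
    isOpen_Ioo.preimage (by fun_prop), ?_, ?_⟩
  · rintro _ ⟨θ, rfl⟩
    simp only [mem_preimage]
    rw [mul_sqrt_polarPoint (scale_pos μ) (by linarith [(hb θ).1])]
    exact hb θ
  · rintro _ ⟨γ, T, hT, hγ, hγT, -, rfl⟩ hsub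
    have hγU : ∀ t, scale μ * √(γ t 0 ^ 2 + γ t 1 ^ 2) ∈ Ioo (size μ / 4) (4 * size μ) :=
      fun t => hsub ⟨t, rfl⟩
    have hpos : ∀ t, 0 < γ t 0 ^ 2 + γ t 1 ^ 2 := fun t => by
      refine sqrt_pos.1 (pos_of_mul_pos_right ?_ (scale_pos μ).le)
      linarith [(hγU t).1]
    obtain ⟨R, ϑ, n, θ₀, hn, hϑ, hR, hRϑ, hγR, hRn⟩ := exists_polar_of_periodic (one_le_scale μ)
      (abs_fst_le_scale μ) (abs_snd_le_scale μ) hc hT hγ hγT hpos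
      (fun t => by linarith [(hγU t).2])
    have hRb : ∀ θ, R θ ∈ Ioo (size μ / 4) (4 * size μ) := fun θ => by
      obtain ⟨t, rfl⟩ := hϑ θ
      rw [hRϑ]
      exact hγU t
    have hfn : ∀ (m : ℕ) θ, flow (radius μ, scaled μ) (θ + m * (2 * π)) =
        flow (radius μ, scaled μ) θ := fun m θ =>
      (show Function.Periodic (flow (radius μ, scaled μ)) (2 * π) from
        flow_add_two_pi hfix).nat_mul m θ
    have heq : R = flow (radius μ, scaled μ) := hs.eq_of_periodic hη
      (fun θ => by
        have h1 := hR θ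
        rw [← hfield _ θ (hRb θ)] at h1
        exact h1)
      hper hRb hb hn hRn (hfn n θ₀)
    rw [cycle, ← heq]
    ext p
    constructor
    · rintro ⟨t, rfl⟩
      exact ⟨ϑ t, (hγR t).symm⟩
    · rintro ⟨θ, rfl⟩
      obtain ⟨t, rfl⟩ := hϑ θ
      exact ⟨t, hγR t⟩

lemma cycle_subset_ball (hη : IsThreshold η) (hμ : μ ∈ region η) {ε : ℝ} (hε : 4 * size μ < ε) :
    cycle μ ⊆ Metric.ball 0 ε := by
  rintro _ ⟨θ, rfl⟩
  obtain ⟨h1, h2⟩ := flow_mem hη hμ θ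
  have hd := (isSmall_of_mem hη hμ).d_pos
  have hR : |flow (radius μ, scaled μ) θ / scale μ| < ε := by
    rw [abs_div, abs_of_pos (by linarith : 0 < flow (radius μ, scaled μ) θ),
      abs_of_pos (scale_pos μ)]
    exact (div_le_self (by linarith) (one_le_scale μ)).trans_lt (h2.trans hε)
  rw [mem_ball_zero_iff, pi_norm_lt_iff (by linarith)]
  intro i
  fin_cases i
  · change |flow (radius μ, scaled μ) θ / scale μ * cos θ| < ε
    rw [abs_mul]
    exact (mul_le_of_le_one_right (abs_nonneg _) (abs_cos_le_one θ)).trans_lt hR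
  · change |flow (radius μ, scaled μ) θ / scale μ * sin θ| < ε
    rw [abs_mul]
    exact (mul_le_of_le_one_right (abs_nonneg _) (abs_sin_le_one θ)).trans_lt hR

lemma radius_div_mem_cycle (μ : ℝ × ℝ × ℝ) : ![radius μ / scale μ, 0] ∈ cycle μ :=
  ⟨0, by simp [polarPoint, flow_zero]⟩

lemma smul_mem_region {a b c s : ℝ} (h : (a, b, c) ∈ region η) (hs0 : 0 < s) (hs1 : s ≤ 1) :
    (a, b, s * c) ∈ region η := by
  refine ⟨?_, ?_⟩
  · have h1 := mul_neg_of_pos_of_neg hs0 h.1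
    simp only at h1 ⊢
    linarith
  · refine lt_of_le_of_lt ?_ h.2
    simp only
    rw [abs_mul, abs_of_pos hs0]
    have := mul_le_of_le_one_left (abs_nonneg c) hs1
    linarith

lemma eventually_mem_region (hη : IsThreshold η) {a b : ℝ} (hab : a * b ≠ 0) {ε : ℝ} (hε : 0 < ε) :
    ∀ᶠ μ in 𝓝 (a, b, (0 : ℝ)),
      μ.1 * μ.2.1 * μ.2.2 < 0 → μ ∈ region η ∧ cycle μ ⊆ Metric.ball 0 ε := by
  have hm := strength_pos (μ := (a, b, 0)) hab
  have e1 : ∀ᶠ μ in 𝓝 (a, b, (0 : ℝ)), 4 * |μ.2.2| < η ^ 2 * strength μ ^ 3 := by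
    refine ContinuousAt.eventually_lt (by fun_prop)
      ((continuous_strength.pow 3).const_mul _).continuousAt ?_
    have := hη.pos
    simp only [abs_zero, mul_zero]
    positivity
  have e2 : ∀ᶠ μ in 𝓝 (a, b, (0 : ℝ)), 4 * size μ < ε := by
    refine ((continuousAt_size (μ := (a, b, 0)) hab).const_mul 4).eventually_lt_const ?_
    simpa [size] using hε
  filter_upwards [e1, e2] with μ h1 h2 h3
  exact ⟨⟨h3, h1⟩, cycle_subset_ball hη ⟨h3, h1⟩ h2⟩

lemma region_nonempty (hη : IsThreshold η) : (region η).Nonempty := by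
  have h := eventually_mem_region hη (a := 1) (b := 1) (by norm_num) one_pos
  have ht : Tendsto (fun c : ℝ => ((1 : ℝ), (1 : ℝ), c)) (𝓝[<] 0) (𝓝 (1, 1, 0)) :=
    (Continuous.tendsto (by fun_prop) (0 : ℝ)).mono_left nhdsWithin_le_nhds
  obtain ⟨c, hc, hc0⟩ := ((ht.eventually h).and self_mem_nhdsWithin).exists
  exact ⟨_, (hc (by simpa using hc0)).1⟩

end Kukles

theorem mainTheorem3 :
    ∃ (N : Set (ℝ × ℝ × ℝ)) (Γ : ℝ × ℝ × ℝ → Set (Fin 2 → ℝ)) (ρ : ℝ × ℝ × ℝ → ℝ),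
      IsOpen N ∧ N.Nonempty ∧
      (∀ μ ∈ N, (kukles μ).IsLimitCycle (Γ μ) ∧ 0 < ρ μ ∧ ![ρ μ, 0] ∈ Γ μ) ∧
      ContinuousOn ρ N ∧
      (∀ a b c : ℝ, (a, b, c) ∈ N →
        a * b * c < 0 ∧ ∀ s : ℝ, 0 < s → s ≤ 1 → (a, b, s * c) ∈ N) ∧
      ∀ a b : ℝ, a * b ≠ 0 →
        (kukles (a, b, 0)).IsWeakFocusOfOrder 1 ∧
        PlanarField.HopfCrossing (fun c => kukles (a, b, c)) 0 ∧
        ∀ ε : ℝ, 0 < ε → ∀ᶠ μ in nhds (a, b, (0 : ℝ)),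
          μ.1 * μ.2.1 * μ.2.2 < 0 → μ ∈ N ∧ Γ μ ⊆ Metric.ball 0 ε := by
  obtain ⟨η, hη⟩ := Kukles.exists_isThreshold
  refine ⟨Kukles.region η, Kukles.cycle, fun μ => Kukles.radius μ / Kukles.scale μ,
    Kukles.isOpen_region η, Kukles.region_nonempty hη, fun μ hμ => ⟨Kukles.isLimitCycle_cycle hη hμ,
      div_pos ?_ (Kukles.scale_pos μ), Kukles.radius_div_mem_cycle μ⟩,
    (Kukles.continuousOn_radius hη).div Kukles.continuous_scale.continuousOn
      fun μ _ => (Kukles.scale_pos μ).ne',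
    fun a b c h => ⟨h.1, fun s => Kukles.smul_mem_region h⟩,
    fun a b hab => ⟨Kukles.isWeakFocusOfOrder_kukles hab, Kukles.hopfCrossing_kukles a b,
      fun ε hε => Kukles.eventually_mem_region hη hab hε⟩⟩
  linarith [(Kukles.radius_spec hη hμ).1.1, (Kukles.isSmall_of_mem hη hμ).d_pos]
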